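/- **Setting.** Two blocks $\mathbf\Omega_+,\mathbf\Omega_-$ carry grids and meet along a fault grid $\mathbf\Gamma$ with $m$ points; every other boundary segment is exterior. A subscript $\pm$ refers to the block; boldface letters are grid functions, and products, quotients and nonlinear functions of grid functions act pointwise. On each block there are positive density and shear modulus $\boldsymbol\rho,\boldsymbol\mu$, a positive diagonal quadrature $\mathbf H_\Omega$, and for each boundary segment $\zeta$ a positive diagonal quadrature $\mathbf H_\zeta$ (the same $\mathbf H_\Gamma$ from both sides of the fault), a restriction operator $\mathbf e_\zeta^T$, a traction operator $\mathbf T_\zeta$, a penalty parameter $\gamma$ and the impedance $\mathbf Z=\sqrt{\boldsymbol\rho\boldsymbol\mu}$ (with $\boldsymbol\rho,\boldsymbol\mu$ restricted to $\zeta$ and positive there). The operator $\mathbf D_{II}(\boldsymbol\mu)\approx\partial_I\mu\partial_I$ has the summation-by-parts property: for all grid functions, $$\mathbf v^T\mathbf H_\Omega\mathbf D_{II}(\boldsymbol\mu)\mathbf u=\sum_\zeta(\mathbf e_\zeta^T\mathbf v)^T\mathbf H_\zeta\mathbf T_\zeta\mathbf u-\sum_{I=1}^2(\mathbf D_I\mathbf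 v)^T\mathbf H_\Omega\,\mathrm{diag}(\boldsymbol\mu)\mathbf D_I\mathbf u-\mathbf v^T\mathbf R_\Delta\mathbf u,\qquad \mathbf R_\Delta=\mathbf R_\Delta^T\ge0 .$$ Put $\boldsymbol\tau=\mathbf T_\zeta\mathbf u$, $\tilde{\boldsymbol\tau}=\boldsymbol\tau+\gamma(\mathbf u^*-\mathbf e_\zeta^T\mathbf u)$ and $$\mathbf L(\mathbf u,\mathbf u^*,\boldsymbol\tau^*)=\mathbf D_{II}(\boldsymbol\mu)\mathbf u+\sum_\zeta\mathbf H_\Omega^{-1}\bigl(\mathbf e_\zeta\mathbf H_\zeta(\boldsymbol\tau^*-\boldsymbol\tau)-\mathbf T_\zeta^T\mathbf H_\zeta(\mathbf u^*-\mathbf e_\zeta^T\mathbf u)\bigr).$$ **Flux laws.** Let $\sigma=1$ or $\sigma=-1$ and let $\boldsymbol\Phi$ be a fault grid function. Put $\mathbf w=\sigma\mathbf Z\,\mathbf e_\zeta^T\dot{\mathbf u}-\tilde{\boldsymbol\tau}$ on each segment. On exterior segments, with reflection coefficients $\mathbf R$ (non-reflecting: $\mathbf R=0$), $$\boldsymbol\tau^*=\tfrac{\mathbf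 R-\mathbf I}2\mathbf w,\qquad \sigma\dot{\mathbf u}^*=\tfrac{\mathbf R+\mathbf I}2(\sigma\mathbf e_\zeta^T\dot{\mathbf u}-\mathbf Z^{-1}\tilde{\boldsymbol\tau}).$$ On the fault, $\boldsymbol\tau^*_\pm=\mp\boldsymbol\Phi$ and $\sigma\dot{\mathbf u}^*_\pm=\sigma\mathbf e_\Gamma^T\dot{\mathbf u}_\pm-\mathbf Z_\pm^{-1}(\tilde{\boldsymbol\tau}_\pm-\boldsymbol\tau^*_\pm)$, and $\mathbf V^*$ satisfies exactly $$\frac{\mathbf Z_+\mathbf Z_-}{\mathbf Z_++\mathbf Z_-}\mathbf V^*+\boldsymbol\Phi=-\frac{\mathbf Z_+\mathbf w_--\mathbf Z_-\mathbf w_+}{\mathbf Z_++\mathbf Z_-}.$$ **Forward scheme.** Let $F,G$ be functions of slip velocity $V$, state $\Psi$ and a scalar parameter $p$; they may depend on the fault grid point through other fixed parameters. Given a fault grid function $\mathbf p$ and an initial state $\boldsymbol\Psi_0$, the forward scheme on $[0,T]$, $T>0$, consists of the flux laws with $\sigma=1$, $\boldsymbol\Phi=\mathbf F(\mathbf V^*,\boldsymbol\Psi,\mathbf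 p)$, together with $$\boldsymbol\rho\ddot{\mathbf u}=\mathbf L(\mathbf u,\mathbf u^*,\boldsymbol\tau^*)\ \text{(on each block)},\qquad\dot{\boldsymbol\Psi}=\mathbf G(\mathbf V^*,\boldsymbol\Psi,\mathbf p),$$ and $\mathbf u(0)=\mathbf u_0$, $\dot{\mathbf u}(0)=\mathbf v_0$, $\mathbf u^*(0)=\mathbf e_\zeta^T\mathbf u_0$, $\boldsymbol\Psi(0)=\boldsymbol\Psi_0$, where $\mathbf u_0,\mathbf v_0$ do not depend on $\mathbf p,\boldsymbol\Psi_0$. **Misfit.** Let $\mathbf m=\mathbf u$ or $\mathbf m=\dot{\mathbf u}$. With receiver grid functions $\hat{\boldsymbol\delta}^{(k)}$ and continuous data $m^{(k)}_{data}$ put $\mathbf r^{(k)}=\langle\hat{\boldsymbol\delta}^{(k)},\mathbf m\rangle_{\mathbf\Omega}-m^{(k)}_{data}$, the inner product being summed over both blocks, and $\boldsymbol{\mathcal F}=\frac12\sum_k\int_0^T|\mathbf r^{(k)}|^2\,dt$. **Adjoint scheme.** With partial derivatives of $F,G$ evaluated pointwise along the forward solution for $(\mathbf p,\boldsymbol\Psi_0)$,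 it consists of the flux laws for the adjoint variables with $\sigma=-1$ and $\boldsymbol\Phi=\mathbf F_V\mathbf V^{\dagger*}+\mathbf G_V\boldsymbol\Psi^\dagger$, together with $$\boldsymbol\rho\ddot{\mathbf u}^\dagger=\mathbf L(\mathbf u^\dagger,\mathbf u^{\dagger*},\boldsymbol\tau^{\dagger*})+\mathbf Q^\dagger,\qquad-\dot{\boldsymbol\Psi}^\dagger=\mathbf G_\Psi\boldsymbol\Psi^\dagger+\mathbf F_\Psi\mathbf V^{\dagger*},$$ and zero values of $\mathbf u^\dagger,\dot{\mathbf u}^\dagger,\mathbf u^{\dagger*},\boldsymbol\Psi^\dagger$ at $t=T$. Here $\mathbf Q^\dagger=\sum_k S^{(k)}\hat{\boldsymbol\delta}^{(k)}$, with $S^{(k)}=\mathbf r^{(k)}$ if $\mathbf m=\dot{\mathbf u}$, and $S^{(k)}(t)=-\bigl(\int_0^t\mathbf r^{(k)}-\int_0^T\mathbf r^{(k)}\bigr)$ if $\mathbf m=\mathbf u$. **Lemma.** Suppose that at each fault grid point $F$ is continuously differentiable with $F_V>0$ for all real $V,\Psi$ and all $p$ in an open set containing the value of $\mathbf p$ there,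 that $G$ is continuously differentiable near every point $(V,\Psi,p)$ visited by the forward solution for $(\mathbf p,\boldsymbol\Psi_0)$, and that the forward scheme has a solution on $[0,T]$ for all parameters near $\mathbf p$ (with initial state $\boldsymbol\Psi_0$) and for all initial states near $\boldsymbol\Psi_0$ (with parameter $\mathbf p$). Let $\mathbf V^{\dagger*},\boldsymbol\Psi^\dagger$ belong to a solution of the adjoint scheme. Then the misfit of the forward solution is differentiable as a function of the parameter at $\mathbf p$ and as a function of the initial state at $\boldsymbol\Psi_0$, with gradients $$\frac{\partial\boldsymbol{\mathcal F}}{\partial\mathbf p}=-\int_0^T\mathbf H_\Gamma\bigl(\mathbf F_p\mathbf V^{\dagger*}+\mathbf G_p\boldsymbol\Psi^\dagger\bigr)\,dt,\qquad \frac{\partial\boldsymbol{\mathcal F}}{\partial\boldsymbol\Psi_0}=-\mathbf H_\Gamma\boldsymbol\Psi^\dagger(0).$$ Moreover the scheme is dual consistent: let $(\mathbf y,\mathbf y^*,\mathbf V_y,\boldsymbol\Psi_y)$ satisfy the flux laws with $\sigma=1$, $\boldsymbol\Phi=\mathbf F_V\mathbf V_y+\mathbf F_\Psi\boldsymbol\Psi_y$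 and have zero initial values, let $(\mathbf z,\mathbf z^*,\mathbf V_z,\boldsymbol\Psi_z)$ satisfy the flux laws with $\sigma=-1$, $\boldsymbol\Phi=\mathbf F_V\mathbf V_z+\mathbf G_V\boldsymbol\Psi_z$ and have zero terminal values, and let $\dot{\mathbf y},\dot{\mathbf z},\boldsymbol\Psi_y,\boldsymbol\Psi_z$ be continuously differentiable on $[0,T]$. Then, with inner products weighted by $\mathbf H_\Omega$ (summed over both blocks) and $\mathbf H_\Gamma$, and $\boldsymbol\tau_y^*,\boldsymbol\tau_z^*$ the corresponding target tractions, $$\int_0^T\!\Bigl(\langle\dot{\mathbf z},\boldsymbol\rho\ddot{\mathbf y}-\mathbf L(\mathbf y,\mathbf y^*,\boldsymbol\tau_y^*)\rangle_{\mathbf\Omega}+\langle\boldsymbol\Psi_z,\dot{\boldsymbol\Psi}_y-\mathbf G_V\mathbf V_y-\mathbf G_\Psi\boldsymbol\Psi_y\rangle_{\mathbf\Gamma}\Bigr)dt$$ $$=-\int_0^T\!\Bigl(\langle\boldsymbol\rho\ddot{\mathbf z}-\mathbf L(\mathbf z,\mathbf z^*,\boldsymbol\tau_z^*),\dot{\mathbf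 y}\rangle_{\mathbf\Omega}+\langle\dot{\boldsymbol\Psi}_z+\mathbf G_\Psi\boldsymbol\Psi_z+\mathbf F_\Psi\mathbf V_z,\boldsymbol\Psi_y\rangle_{\mathbf\Gamma}\Bigr)dt .$$ -/

import Mathlib

open Set Filter Topology MeasureTheory
open scoped Matrix

namespace AntiplaneShear

noncomputable section

/-! ### Grid functions, quadratures and SBP operators -/

/-- The discrete bilinear form `xᵀ H y` of a diagonal quadrature `H = diag h`. -/
def ip {k : ℕ} (h x y : Fin k → ℝ) : ℝ := ∑ i, h i * x i * y i

/-- A boundary segment with `k` grid points of a block with `n` grid points. -/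
structure Segment (n k : ℕ) where
  /-- The boundary restriction operator, written `eᵀ` in formulas such as `eᵀ u`. -/
  e : Matrix (Fin k) (Fin n) ℝ
  /-- The boundary traction operator, approximating `μ ∂ₙ`. -/
  Tr : Matrix (Fin k) (Fin n) ℝ
  /-- Weights of the boundary quadrature. -/
  h : Fin k → ℝ
  h_pos : ∀ i, 0 < h i
  /-- Penalty parameter of the modified traction (possibly varying along the segment). -/
  γ : Fin k → ℝ

/-- One block of the domain, with its diagonal-norm SBP discretization of the
variable-coefficient Laplacian `∂_I μ ∂_I` in two space dimensions. The boundary grid consists of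
the exterior segments `ext ζ` and of one fault segment with `m` points. -/
structure Block (m : ℕ) where
  /-- Number of grid points. -/
  n : ℕ
  /-- Density. -/
  ρ : Fin n → ℝ
  /-- Shear modulus. -/
  μ : Fin n → ℝ
  ρ_pos : ∀ i, 0 < ρ i
  μ_pos : ∀ i, 0 < μ i
  /-- Weights of the volume quadrature. -/
  h : Fin n → ℝ
  h_pos : ∀ i, 0 < h i
  /-- Number of exterior boundary segments. -/
  nExt : ℕ
  /-- Number of grid points on each exterior segment. -/
  k : Fin nExt → ℕ
  ext : ∀ ζ, Segment n (k ζ)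
  /-- Reflection coefficients: `-1` rigid wall, `1` traction-free, `0` non-reflecting. -/
  R : ∀ ζ, Fin (k ζ) → ℝ
  fault : Segment n m
  /-- The operator `D_II(μ)`. -/
  D : Matrix (Fin n) (Fin n) ℝ
  /-- The first-derivative operators `D_1`, `D_2`. -/
  D1 : Fin 2 → Matrix (Fin n) (Fin n) ℝ
  /-- The positive semidefinite remainder `R_Δ`. -/
  RΔ : Matrix (Fin n) (Fin n) ℝ
  RΔ_posSemidef : RΔ.PosSemidef
  /-- The material parameters are positive at the boundary grid points. -/
  ext_ρ_pos : ∀ ζ i, 0 < ((ext ζ).e *ᵥ ρ) i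
  ext_μ_pos : ∀ ζ i, 0 < ((ext ζ).e *ᵥ μ) i
  fault_ρ_pos : ∀ i, 0 < (fault.e *ᵥ ρ) i
  fault_μ_pos : ∀ i, 0 < (fault.e *ᵥ μ) i
  /-- The summation-by-parts property. -/
  sbp : ∀ v u : Fin n → ℝ,
    ip h v (D *ᵥ u) =
      (∑ ζ, ip (ext ζ).h ((ext ζ).e *ᵥ v) ((ext ζ).Tr *ᵥ u))
        + ip fault.h (fault.e *ᵥ v) (fault.Tr *ᵥ u)
        - (∑ I, ip h (D1 I *ᵥ v) (μ * (D1 I *ᵥ u)))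
        - v ⬝ᵥ (RΔ *ᵥ u)

/-- The two sides of the fault: `true` is the side `+`, `false` is the side `-`. -/
abbrev Side := Bool

/-- `+1` on the side `+` and `-1` on the side `-`. -/
def sgn (s : Side) : ℝ := if s then 1 else -1

/-- A two-block discretization, conforming along a fault grid with `m` points. -/
structure Scheme (m : ℕ) where
  blk : Side → Block m
  /-- Both sides use the same fault quadrature. -/
  fault_h : (blk true).fault.h = (blk false).fault.h

/-- Weights of the fault quadrature `H_Γ`. -/
def Scheme.hΓ {m : ℕ} (sc : Scheme m) : Fin m → ℝ := (sc.blk true).fault.h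

/-! ### The characteristics-based non-stiff SAT -/

section SAT

variable {n k : ℕ}

/-- The traction `τ = T u`. -/
def Segment.traction (g : Segment n k) (u : Fin n → ℝ) : Fin k → ℝ := g.Tr *ᵥ u

/-- The modified traction `τ + γ (u* - u)`. -/
def Segment.modTraction (g : Segment n k) (u : Fin n → ℝ) (us : Fin k → ℝ) : Fin k → ℝ :=
  g.traction u + g.γ * (us - g.e *ᵥ u)

/-- `SAT(u, u*, τ*) = H_Ω⁻¹ (e H_ζ (τ* - τ) - Tᵀ H_ζ (u* - u))`. -/
def Segment.sat (g : Segment n k) (hΩ : Fin n → ℝ) (u : Fin n → ℝ) (us τs : Fin k → ℝ) :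
    Fin n → ℝ := fun i =>
  (hΩ i)⁻¹ * ((g.eᵀ *ᵥ (g.h * (τs - g.traction u))) i
    - (g.Trᵀ *ᵥ (g.h * (us - g.e *ᵥ u))) i)

/-- The shear impedance `Z = √(ρ μ)` on a segment, for volume grid functions `ρ`, `μ`. -/
def Segment.imp (g : Segment n k) (ρ μ : Fin n → ℝ) : Fin k → ℝ := fun i =>
  Real.sqrt ((g.e *ᵥ ρ) i * (g.e *ᵥ μ) i)

end SAT

/-- The unknowns of the scheme at one time: displacements and velocities in the blocks, target
displacements `u*` on the exterior segments and on the two sides of the fault, the target slip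
velocity `V*` and the state variable `Ψ`. The same type serves the forward, the linearized and
the adjoint scheme. -/
structure State {m : ℕ} (sc : Scheme m) where
  u : ∀ s, Fin (sc.blk s).n → ℝ
  v : ∀ s, Fin (sc.blk s).n → ℝ
  uExt : ∀ s ζ, Fin ((sc.blk s).k ζ) → ℝ
  uFault : ∀ _ : Side, Fin m → ℝ
  V : Fin m → ℝ
  Ψ : Fin m → ℝ

section Flux

variable {m : ℕ} (sc : Scheme m)

/-- Impedance on an exterior segment. -/
def zExt (s : Side) (ζ : Fin (sc.blk s).nExt) : Fin ((sc.blk s).k ζ) → ℝ :=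
  ((sc.blk s).ext ζ).imp (sc.blk s).ρ (sc.blk s).μ

/-- Impedance on the two sides of the fault. -/
def zFault (s : Side) : Fin m → ℝ := (sc.blk s).fault.imp (sc.blk s).ρ (sc.blk s).μ

/-- Outgoing characteristic variable on an exterior segment: `Z u̇ - τ̃` forward in time (`σ = 1`)
and `-Z u̇ - τ̃` for the time-reversed adjoint (`σ = -1`). -/
def wExt (σ : ℝ) (x : State sc) (s : Side) (ζ : Fin (sc.blk s).nExt) :
    Fin ((sc.blk s).k ζ) → ℝ :=
  zExt sc s ζ * (σ • (((sc.blk s).ext ζ).e *ᵥ x.v s))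
    - ((sc.blk s).ext ζ).modTraction (x.u s) (x.uExt s ζ)

/-- Outgoing characteristic variable on the two sides of the fault. -/
def wFault (σ : ℝ) (x : State sc) (s : Side) : Fin m → ℝ :=
  zFault sc s * (σ • ((sc.blk s).fault.e *ᵥ x.v s))
    - (sc.blk s).fault.modTraction (x.u s) (x.uFault s)

/-- Target traction `τ* = (R - I)/2 w` on an exterior segment. -/
def tauExt (σ : ℝ) (x : State sc) (s : Side) (ζ : Fin (sc.blk s).nExt) :
    Fin ((sc.blk s).k ζ) → ℝ := fun i =>
  ((sc.blk s).R ζ i - 1) / 2 * wExt sc σ x s ζ i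

/-- Target traction `τ*_± = ∓ Φ` on the fault, where `Φ` is the value of the fault law. -/
def tauFault (Φ : Fin m → ℝ) (s : Side) : Fin m → ℝ := fun i => -(sgn s) * Φ i

/-- `L*(σ u̇, τ̃) = (R + I)/2 (σ u̇ - Z⁻¹ τ̃)` on an exterior segment. -/
def lStarExt (σ : ℝ) (x : State sc) (s : Side) (ζ : Fin (sc.blk s).nExt) :
    Fin ((sc.blk s).k ζ) → ℝ := fun i =>
  ((sc.blk s).R ζ i + 1) / 2 *
    (σ * (((sc.blk s).ext ζ).e *ᵥ x.v s) i
      - (zExt sc s ζ i)⁻¹ * ((sc.blk s).ext ζ).modTraction (x.u s) (x.uExt s ζ) i)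

/-- `L*(σ u̇, τ̃) = σ u̇ - Z⁻¹ (τ̃ - τ*)` on the two sides of the fault. -/
def lStarFault (σ : ℝ) (Φ : Fin m → ℝ) (x : State sc) (s : Side) : Fin m → ℝ := fun i =>
  σ * ((sc.blk s).fault.e *ᵥ x.v s) i
    - (zFault sc s i)⁻¹ *
      ((sc.blk s).fault.modTraction (x.u s) (x.uFault s) i - tauFault Φ s i)

/-- `L(u, u*, τ*) = D_II(μ) u + ∑ SAT`, the sum over all exterior segments and the fault. -/
def opL (σ : ℝ) (Φ : Fin m → ℝ) (x : State sc) (s : Side) : Fin (sc.blk s).n → ℝ :=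
  (sc.blk s).D *ᵥ x.u s
    + (∑ ζ, ((sc.blk s).ext ζ).sat (sc.blk s).h (x.u s) (x.uExt s ζ) (tauExt sc σ x s ζ))
    + (sc.blk s).fault.sat (sc.blk s).h (x.u s) (x.uFault s) (tauFault Φ s)

/-- `κ = Z₊ Z₋ / (Z₊ + Z₋)`. -/
def kappa : Fin m → ℝ := fun i =>
  zFault sc true i * zFault sc false i / (zFault sc true i + zFault sc false i)

/-- `τ_ℓ = (Z₊ w₋ - Z₋ w₊) / (Z₊ + Z₋)`. -/
def tauEll (σ : ℝ) (x : State sc) : Fin m → ℝ := fun i =>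
  (zFault sc true i * wFault sc σ x false i - zFault sc false i * wFault sc σ x true i)
    / (zFault sc true i + zFault sc false i)

/-- The part of the scheme on `[0, T]` shared by the forward scheme (`σ = 1`) and the adjoint
scheme (`σ = -1`), for the fault law with value `Φ t` at time `t`: `u̇ = v`, the evolution
`σ u̇* = L*(σ u̇, τ̃)` of the target displacements, and the exact algebraic equation
`κ V* + Φ = -τ_ℓ` for the target slip velocity. -/
structure FluxLaws (σ T : ℝ) (Φ : ℝ → Fin m → ℝ) (X : ℝ → State sc) : Prop where
  vel : ∀ t ∈ Icc 0 T, ∀ s,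
    HasDerivWithinAt (fun r => (X r).u s) ((X t).v s) (Icc 0 T) t
  ext : ∀ t ∈ Icc 0 T, ∀ s ζ,
    HasDerivWithinAt (fun r => σ • (X r).uExt s ζ) (lStarExt sc σ (X t) s ζ) (Icc 0 T) t
  fault : ∀ t ∈ Icc 0 T, ∀ s,
    HasDerivWithinAt (fun r => σ • (X r).uFault s) (lStarFault sc σ (Φ t) (X t) s) (Icc 0 T) t
  slip : ∀ t ∈ Icc 0 T, ∀ i, kappa sc i * (X t).V i + Φ t i = -tauEll sc σ (X t) i

/-- All components with prescribed initial or terminal data vanish. -/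
structure State.IsZero {sc : Scheme m} (x : State sc) : Prop where
  u : ∀ s, x.u s = 0
  v : ∀ s, x.v s = 0
  uExt : ∀ s ζ, x.uExt s ζ = 0
  uFault : ∀ s, x.uFault s = 0
  Ψ : x.Ψ = 0

end Flux

/-! ### Friction and state evolution laws

`F i V Ψ q` and `G i V Ψ q` are the values at the fault grid point `i` for slip velocity `V`,
state `Ψ` and value `q` of the parameter that is inverted for; all other parameters are absorbed
in the dependence on `i`. -/

/-- Pointwise laws on a fault grid with `m` points. -/
abbrev FaultLaw (m : ℕ) := Fin m → ℝ → ℝ → ℝ → ℝ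

section Laws

variable {m : ℕ} {sc : Scheme m}

/-- Pointwise evaluation of a law at the slip velocity `V*` and the state `Ψ`. -/
def FaultLaw.eval (F : FaultLaw m) (p : Fin m → ℝ) (x : State sc) : Fin m → ℝ := fun i =>
  F i (x.V i) (x.Ψ i) (p i)

/-- Pointwise partial derivative with respect to `V`. -/
def FaultLaw.dV (F : FaultLaw m) (p : Fin m → ℝ) (x : State sc) : Fin m → ℝ := fun i =>
  deriv (fun y => F i y (x.Ψ i) (p i)) (x.V i)

/-- Pointwise partial derivative with respect to `Ψ`. -/
def FaultLaw.dΨ (F : FaultLaw m) (p : Fin m → ℝ) (x : State sc) : Fin m → ℝ := fun i =>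
  deriv (fun y => F i (x.V i) y (p i)) (x.Ψ i)

/-- Pointwise partial derivative with respect to the parameter. -/
def FaultLaw.dp (F : FaultLaw m) (p : Fin m → ℝ) (x : State sc) : Fin m → ℝ := fun i =>
  deriv (fun y => F i (x.V i) (x.Ψ i) y) (p i)

/-- A law linearized at `x`, in the direction `y`: `F_V V + F_Ψ Ψ`. -/
def FaultLaw.lin (F : FaultLaw m) (p : Fin m → ℝ) (x y : State sc) : Fin m → ℝ :=
  F.dV p x * y.V + F.dΨ p x * y.Ψ

/-- The adjoint friction law `F† = F_V V† + G_V Ψ†`, with coefficients evaluated at `x`. -/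
def adjF (F G : FaultLaw m) (p : Fin m → ℝ) (x y : State sc) : Fin m → ℝ :=
  F.dV p x * y.V + G.dV p x * y.Ψ

/-- The adjoint state evolution law `G† = G_Ψ Ψ† + F_Ψ V†`, with coefficients evaluated at `x`. -/
def adjG (F G : FaultLaw m) (p : Fin m → ℝ) (x y : State sc) : Fin m → ℝ :=
  G.dΨ p x * y.Ψ + F.dΨ p x * y.V

end Laws

/-! ### The forward scheme -/

/-- `X` solves the semi-discrete forward scheme on `[0, T]` with parameter grid function `p`,
initial displacement `u0`, initial velocity `v0` and initial state `Ψ0`. -/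
structure IsForward {m : ℕ} (sc : Scheme m) (T : ℝ) (F G : FaultLaw m)
    (u0 v0 : ∀ s, Fin (sc.blk s).n → ℝ) (p Ψ0 : Fin m → ℝ) (X : ℝ → State sc) : Prop where
  flux : FluxLaws sc 1 T (fun t => F.eval p (X t)) X
  momentum : ∀ t ∈ Icc 0 T, ∀ s,
    HasDerivWithinAt (fun r => (X r).v s)
      (fun i => ((sc.blk s).ρ i)⁻¹ * opL sc 1 (F.eval p (X t)) (X t) s i) (Icc 0 T) t
  state : ∀ t ∈ Icc 0 T, HasDerivWithinAt (fun r => (X r).Ψ) (G.eval p (X t)) (Icc 0 T) t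
  init_u : ∀ s, (X 0).u s = u0 s
  init_v : ∀ s, (X 0).v s = v0 s
  init_uExt : ∀ s ζ, (X 0).uExt s ζ = ((sc.blk s).ext ζ).e *ᵥ u0 s
  init_uFault : ∀ s, (X 0).uFault s = (sc.blk s).fault.e *ᵥ u0 s
  init_Ψ : (X 0).Ψ = Ψ0

/-! ### Misfit and adjoint source -/

/-- The measured field: particle displacement or particle velocity. -/
inductive Quantity where
  | displacement
  | velocity

/-- Receivers: for each of them a discrete Dirac delta on the grid and a recorded signal. -/
structure Receivers {m : ℕ} (sc : Scheme m) where
  N : ℕ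
  δ : Fin N → ∀ s, Fin (sc.blk s).n → ℝ
  data : Fin N → ℝ → ℝ

section Misfit

variable {m : ℕ} {sc : Scheme m}

/-- The measured grid function. -/
def Quantity.field (q : Quantity) (x : State sc) (s : Side) : Fin (sc.blk s).n → ℝ :=
  match q with
  | .displacement => x.u s
  | .velocity => x.v s

/-- The residual `r⁽ᵏ⁾(t)`. -/
def residual (rec : Receivers sc) (q : Quantity) (X : ℝ → State sc) (k : Fin rec.N) (t : ℝ) : ℝ :=
  (∑ s, ip (sc.blk s).h (rec.δ k s) (q.field (X t) s)) - rec.data k t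

/-- The semi-discrete misfit `½ ∑ₖ ∫₀ᵀ |r⁽ᵏ⁾|² dt`. -/
def misfit (T : ℝ) (rec : Receivers sc) (q : Quantity) (X : ℝ → State sc) : ℝ :=
  1 / 2 * ∑ k, ∫ t in (0 : ℝ)..T, |residual rec q X k t| ^ 2

/-- The signal `S⁽ᵏ⁾(t)`: the residual for velocity measurements, and minus its antiderivative
that vanishes at `T` for displacement measurements. -/
def signal (T : ℝ) (rec : Receivers sc) (q : Quantity) (X : ℝ → State sc) (k : Fin rec.N)
    (t : ℝ) : ℝ :=
  match q with
  | .displacement =>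
      -((∫ r in (0 : ℝ)..t, residual rec q X k r) - ∫ r in (0 : ℝ)..T, residual rec q X k r)
  | .velocity => residual rec q X k t

/-- The adjoint source `Q† = ∑ₖ S⁽ᵏ⁾ δ⁽ᵏ⁾`. -/
def adjSource (T : ℝ) (rec : Receivers sc) (q : Quantity) (X : ℝ → State sc) (t : ℝ) (s : Side) :
    Fin (sc.blk s).n → ℝ := fun i =>
  ∑ k, signal T rec q X k t * rec.δ k s i

end Misfit

/-! ### The adjoint scheme -/

/-- `Y` solves the semi-discrete adjoint scheme on `[0, T]` belonging to the forward solution `X`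
with parameter grid function `p`. -/
structure IsAdjoint {m : ℕ} (sc : Scheme m) (T : ℝ) (F G : FaultLaw m)
    (rec : Receivers sc) (q : Quantity) (p : Fin m → ℝ) (X Y : ℝ → State sc) : Prop where
  flux : FluxLaws sc (-1) T (fun t => adjF F G p (X t) (Y t)) Y
  momentum : ∀ t ∈ Icc 0 T, ∀ s,
    HasDerivWithinAt (fun r => (Y r).v s)
      (fun i => ((sc.blk s).ρ i)⁻¹ *
        (opL sc (-1) (adjF F G p (X t) (Y t)) (Y t) s i + adjSource T rec q X t s i))
      (Icc 0 T) t
  state : ∀ t ∈ Icc 0 T,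
    HasDerivWithinAt (fun r => -(Y r).Ψ) (adjG F G p (X t) (Y t)) (Icc 0 T) t
  terminal : (Y T).IsZero

/-! ### Gradient and dual consistency -/

/-- `f` is (Fréchet) differentiable at `x` and `g` is the vector of its partial derivatives. -/
def HasGridGradientAt {m : ℕ} (f : (Fin m → ℝ) → ℝ) (g x : Fin m → ℝ) : Prop :=
  HasFDerivAt f (∑ i, g i • ContinuousLinearMap.proj (R := ℝ) (φ := fun _ : Fin m => ℝ) i) x

/-- Dual consistency: the adjoint scheme without source is the adjoint, with respect to the
space-time quadratures, of the forward scheme linearized at the forward solution `X`. That is, the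
residuals of the linearized momentum and state equations of any trajectory `y` with zero initial
values, tested with the adjoint velocity and the adjoint state of any trajectory `z` with zero
terminal values, equal minus the residuals of the adjoint momentum and state equations of `z`,
tested with the velocity and the state of `y`. -/
def DualConsistent {m : ℕ} (sc : Scheme m) (T : ℝ) (F G : FaultLaw m) (p : Fin m → ℝ)
    (X : ℝ → State sc) : Prop :=
  ∀ y z : ℝ → State sc,
    FluxLaws sc 1 T (fun t => F.lin p (X t) (y t)) y →
    FluxLaws sc (-1) T (fun t => adjF F G p (X t) (z t)) z →
    (y 0).IsZero → (z T).IsZero →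
    (∀ s, ContDiffOn ℝ 1 (fun t => (y t).v s) (Icc 0 T)) →
    (∀ s, ContDiffOn ℝ 1 (fun t => (z t).v s) (Icc 0 T)) →
    ContDiffOn ℝ 1 (fun t => (y t).Ψ) (Icc 0 T) →
    ContDiffOn ℝ 1 (fun t => (z t).Ψ) (Icc 0 T) →
    (∫ t in (0 : ℝ)..T,
      ((∑ s, ip (sc.blk s).h ((z t).v s)
          ((sc.blk s).ρ * derivWithin (fun r => (y r).v s) (Icc 0 T) t
            - opL sc 1 (F.lin p (X t) (y t)) (y t) s))
        + ip sc.hΓ (z t).Ψ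
            (derivWithin (fun r => (y r).Ψ) (Icc 0 T) t - G.lin p (X t) (y t)))) =
    -∫ t in (0 : ℝ)..T,
      ((∑ s, ip (sc.blk s).h
          ((sc.blk s).ρ * derivWithin (fun r => (z r).v s) (Icc 0 T) t
            - opL sc (-1) (adjF F G p (X t) (z t)) (z t) s)
          ((y t).v s))
        + ip sc.hΓ
            (derivWithin (fun r => (z r).Ψ) (Icc 0 T) t + adjG F G p (X t) (z t)) (y t).Ψ)

end

end AntiplaneShear

/-!
The proof rests on an energy balance for a pair of trajectories: a forward one `y` (`σ = 1`) and an
adjoint one `z` (`σ = -1`), with arbitrary values `Φ`, `Θ` of their fault laws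
(`hasDerivWithinAt_energyPairing`). The summation-by-parts property makes the bilinear energy
`energyPairing` (kinetic energy, strain energy and a boundary energy of the SATs) change in time
only through the residuals of the two momentum equations and the fluxes through the segments. On
exterior segments the characteristic conditions of `y` and `z` are dual and the flux is zero; at
the fault it is `⟨Φ, V_z⟩ - ⟨Θ, V_y⟩`.

Dual consistency (`dualConsistent`) follows by inserting the linearized laws, for which the
remaining fault terms are those of the state equations. All integrands are continuous, because
`κ V + Φ = -τ_ℓ` with an increasing friction law determines the slip velocity continuously.

For the gradients, no solution of a linearized forward problem is needed. The balance is applied to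
the difference of two exact forward solutions and the adjoint solution
(`hasDerivWithinAt_adjoint_pairing`); what the adjoint laws do not cancel is the claimed gradient
and Taylor remainders of `F` and `G`. The remainders are of higher order since the laws are
uniformly differentiable along the compact base trajectory
(`FaultLaw.IsC1Along.exists_taylor_bound`) and forward solutions are Lipschitz in the data
(`exists_stability_bound`). The slip velocity is only given implicitly, but monotonicity of the
friction law bounds its perturbation by those of the other unknowns (`slip_stability`). Finally the
source of the adjoint scheme tested with the velocity of the perturbation is the first variation of
the misfit (`sum_integral_residual_mul`).
-/

open Set Filter Topology MeasureTheory
open scoped Matrix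

namespace AntiplaneShear

noncomputable section

/-! ### Calculus of the discrete inner products -/

section Calculus

variable {k l : ℕ}

lemma ip_add_right (h x y z : Fin k → ℝ) : ip h x (y + z) = ip h x y + ip h x z := by
  simp [ip, mul_add, Finset.sum_add_distrib]

lemma ip_sub_right (h x y z : Fin k → ℝ) : ip h x (y - z) = ip h x y - ip h x z := by
  simp [ip, mul_sub, Finset.sum_sub_distrib]

lemma ip_sub_left (h x y z : Fin k → ℝ) : ip h (x - y) z = ip h x z - ip h y z := by
  simp [ip, mul_sub, sub_mul, Finset.sum_sub_distrib]

lemma ip_sum_right {ι : Type*} [Fintype ι] (h x : Fin k → ℝ) (y : ι → Fin k → ℝ) :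
    ip h x (∑ j, y j) = ∑ j, ip h x (y j) := by
  simp only [ip, Finset.sum_apply, Finset.mul_sum]
  exact Finset.sum_comm

lemma ip_comm (h x y : Fin k → ℝ) : ip h x y = ip h y x :=
  Finset.sum_congr rfl fun i _ => by ring

lemma ip_mul_comm (h c x y : Fin k → ℝ) : ip h x (c * y) = ip h y (c * x) :=
  Finset.sum_congr rfl fun i _ => by simp only [Pi.mul_apply]; ring

@[simp] lemma ip_zero_left (h y : Fin k → ℝ) : ip h 0 y = 0 := by simp [ip]

@[simp] lemma ip_zero_right (h x : Fin k → ℝ) : ip h x 0 = 0 := by simp [ip]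

lemma ip_eq_dotProduct (h x y : Fin k → ℝ) : ip h x y = x ⬝ᵥ (h * y) :=
  Finset.sum_congr rfl fun i _ => by simp only [Pi.mul_apply]; ring

lemma hasDerivWithinAt_ip (h : Fin k → ℝ) {x y : ℝ → Fin k → ℝ} {x' y' : Fin k → ℝ} {S : Set ℝ}
    {t : ℝ} (hx : HasDerivWithinAt x x' S t) (hy : HasDerivWithinAt y y' S t) :
    HasDerivWithinAt (fun r => ip h (x r) (y r)) (ip h x' (y t) + ip h (x t) y') S t := by
  rw [hasDerivWithinAt_pi] at hx hy
  have := HasDerivWithinAt.fun_sum (u := Finset.univ)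
    fun i _ => ((hx i).const_mul (h i)).mul (hy i)
  simpa [ip, Finset.sum_add_distrib, Pi.mul_def] using this

lemma hasDerivWithinAt_mulVec (M : Matrix (Fin l) (Fin k) ℝ) {x : ℝ → Fin k → ℝ}
    {x' : Fin k → ℝ} {S : Set ℝ} {t : ℝ} (hx : HasDerivWithinAt x x' S t) :
    HasDerivWithinAt (fun r => M *ᵥ x r) (M *ᵥ x') S t :=
  (LinearMap.toContinuousLinearMap (Matrix.mulVecLin M)).hasFDerivAt.comp_hasDerivWithinAt t hx

lemma hasDerivWithinAt_const_mul_pi (c : Fin k → ℝ) {x : ℝ → Fin k → ℝ}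
    {x' : Fin k → ℝ} {S : Set ℝ} {t : ℝ} (hx : HasDerivWithinAt x x' S t) :
    HasDerivWithinAt (fun r => c * x r) (c * x') S t := by
  rw [hasDerivWithinAt_pi] at hx ⊢
  exact fun i => (hx i).const_mul (c i)

lemma continuousOn_ip (h : Fin k → ℝ) {x y : ℝ → Fin k → ℝ} {S : Set ℝ}
    (hx : ContinuousOn x S) (hy : ContinuousOn y S) :
    ContinuousOn (fun r => ip h (x r) (y r)) S := by
  rw [continuousOn_pi] at hx hy
  exact continuousOn_finsetSum _ fun i _ => (continuousOn_const.mul (hx i)).mul (hy i)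

end Calculus

/-! ### Energy balance of a pair of trajectories -/

section Segment

variable {n k : ℕ}

/-- The bilinear boundary energy of the SAT on one segment. Its time derivative compensates the
parts of the SAT that are not expressed through the target values and the modified traction. -/
def Segment.pairing (g : Segment n k) (y : Fin n → ℝ) (ys : Fin k → ℝ) (z : Fin n → ℝ)
    (zs : Fin k → ℝ) : ℝ :=
  ip g.h (g.traction z) (ys - g.e *ᵥ y) + ip g.h (g.traction y) (zs - g.e *ᵥ z)
    + ip g.h (g.γ * (ys - g.e *ᵥ y)) (zs - g.e *ᵥ z)

/-- The SAT of one segment tested with a grid function `v`. -/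
def Segment.power (g : Segment n k) (v u : Fin n → ℝ) (us τs : Fin k → ℝ) : ℝ :=
  ip g.h (g.e *ᵥ v) τs - ip g.h (g.traction v) (us - g.e *ᵥ u)

/-- The bilinear energy flux through one segment, for the displacements `y`, `z` with velocities
`yv`, `zv`, the target displacements `ys`, `zs` with velocities `ys'`, `zs'`, and the target
tractions `τy`, `τz`. -/
def Segment.flux (g : Segment n k) (y yv : Fin n → ℝ) (ys ys' τy : Fin k → ℝ)
    (z zv : Fin n → ℝ) (zs zs' τz : Fin k → ℝ) : ℝ :=
  ip g.h (g.e *ᵥ zv) τy + ip g.h (g.modTraction z zs) (ys' - g.e *ᵥ yv)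
    + ip g.h (g.e *ᵥ yv) τz + ip g.h (g.modTraction y ys) (zs' - g.e *ᵥ zv)

lemma Segment.ip_sat (g : Segment n k) {hΩ : Fin n → ℝ} (hpos : ∀ i, 0 < hΩ i)
    (v u : Fin n → ℝ) (us τs : Fin k → ℝ) :
    ip hΩ v (g.sat hΩ u us τs) + ip g.h (g.e *ᵥ v) (g.traction u) = g.power v u us τs := by
  have h1 : ip hΩ v (g.sat hΩ u us τs) = v ⬝ᵥ (g.eᵀ *ᵥ (g.h * (τs - g.traction u)))
      - v ⬝ᵥ (g.Trᵀ *ᵥ (g.h * (us - g.e *ᵥ u))) := by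
    rw [ip, dotProduct, dotProduct, ← Finset.sum_sub_distrib]
    refine Finset.sum_congr rfl fun i _ => ?_
    have := (hpos i).ne'
    simp only [Segment.sat]
    field_simp
  rw [h1, Matrix.dotProduct_mulVec, Matrix.dotProduct_mulVec, Matrix.vecMul_transpose,
    Matrix.vecMul_transpose, ← ip_eq_dotProduct, ← ip_eq_dotProduct, ip_sub_right, Segment.power,
    Segment.traction, Segment.traction]
  ring

lemma Segment.hasDerivWithinAt_pairing (g : Segment n k) {y z : ℝ → Fin n → ℝ}
    {ys zs : ℝ → Fin k → ℝ} {yv zv : Fin n → ℝ} {ys' zs' : Fin k → ℝ} {S : Set ℝ} {t : ℝ}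
    (hy : HasDerivWithinAt y yv S t) (hz : HasDerivWithinAt z zv S t)
    (hys : HasDerivWithinAt ys ys' S t) (hzs : HasDerivWithinAt zs zs' S t)
    (τy τz : Fin k → ℝ) :
    HasDerivWithinAt (fun r => g.pairing (y r) (ys r) (z r) (zs r))
      (g.flux (y t) yv (ys t) ys' τy (z t) zv (zs t) zs' τz
        - g.power zv (y t) (ys t) τy - g.power yv (z t) (zs t) τz) S t := by
  have jy := hys.sub (hasDerivWithinAt_mulVec g.e hy)
  have jz := hzs.sub (hasDerivWithinAt_mulVec g.e hz)
  have := ((hasDerivWithinAt_ip g.h (hasDerivWithinAt_mulVec g.Tr hz) jy).add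
    (hasDerivWithinAt_ip g.h (hasDerivWithinAt_mulVec g.Tr hy) jz)).add
    (hasDerivWithinAt_ip g.h (hasDerivWithinAt_const_mul_pi g.γ jy) jz)
  refine this.congr_deriv ?_
  simp only [Segment.flux, Segment.power, Segment.modTraction, Segment.traction, ip,
    ← Finset.sum_add_distrib, ← Finset.sum_sub_distrib]
  refine Finset.sum_congr rfl fun i _ => ?_
  simp only [Pi.sub_apply, Pi.mul_apply, Pi.add_apply]
  ring

lemma Segment.imp_pos (g : Segment n k) {ρ μ : Fin n → ℝ} (i : Fin k) (hρ : 0 < (g.e *ᵥ ρ) i)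
    (hμ : 0 < (g.e *ᵥ μ) i) : 0 < g.imp ρ μ i :=
  Real.sqrt_pos.2 (mul_pos hρ hμ)

end Segment

section Pairing

variable {m : ℕ} (sc : Scheme m)

lemma zExt_pos (s : Side) (ζ : Fin (sc.blk s).nExt) (i) : 0 < zExt sc s ζ i :=
  Segment.imp_pos _ i ((sc.blk s).ext_ρ_pos ζ i) ((sc.blk s).ext_μ_pos ζ i)

lemma zFault_pos (s : Side) (i : Fin m) : 0 < zFault sc s i :=
  Segment.imp_pos _ i ((sc.blk s).fault_ρ_pos i) ((sc.blk s).fault_μ_pos i)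

lemma kappa_pos (i : Fin m) : 0 < kappa sc i := by
  have h1 := zFault_pos sc true i
  have h2 := zFault_pos sc false i
  unfold kappa
  positivity

lemma fault_h_eq (s : Side) : (sc.blk s).fault.h = sc.hΓ := by
  cases s
  · exact sc.fault_h.symm
  · rfl

/-- The SBP property turns `L` tested with `v` into a symmetric bulk form and the powers of the
SATs. -/
lemma ip_opL (σ : ℝ) (Φ : Fin m → ℝ) (x : State sc) (s : Side) (v : Fin (sc.blk s).n → ℝ) :
    ip (sc.blk s).h v (opL sc σ Φ x s) =
      (∑ ζ, ((sc.blk s).ext ζ).power v (x.u s) (x.uExt s ζ) (tauExt sc σ x s ζ))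
        + (sc.blk s).fault.power v (x.u s) (x.uFault s) (tauFault Φ s)
        - (∑ I, ip (sc.blk s).h ((sc.blk s).D1 I *ᵥ v) ((sc.blk s).μ * ((sc.blk s).D1 I *ᵥ x.u s)))
        - v ⬝ᵥ ((sc.blk s).RΔ *ᵥ x.u s) := by
  rw [opL, ip_add_right, ip_add_right, ip_sum_right, (sc.blk s).sbp]
  simp only [← Segment.ip_sat _ (sc.blk s).h_pos, Finset.sum_add_distrib, Segment.traction]
  ring

/-- The bilinear energy of two states, one of the forward and one of the adjoint scheme: kinetic
and strain energy of the blocks, and the boundary energies of the SATs. -/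
def energyPairing (y z : State sc) : ℝ :=
  ∑ s, (ip (sc.blk s).h (z.v s) ((sc.blk s).ρ * y.v s)
    + (∑ I, ip (sc.blk s).h ((sc.blk s).D1 I *ᵥ z.u s)
        ((sc.blk s).μ * ((sc.blk s).D1 I *ᵥ y.u s)))
    + z.u s ⬝ᵥ ((sc.blk s).RΔ *ᵥ y.u s)
    + (∑ ζ, ((sc.blk s).ext ζ).pairing (y.u s) (y.uExt s ζ) (z.u s) (z.uExt s ζ))
    + (sc.blk s).fault.pairing (y.u s) (y.uFault s) (z.u s) (z.uFault s))

variable {sc}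

lemma energyPairing_of_isZero_left {y z : State sc} (hy : y.IsZero) : energyPairing sc y z = 0 := by
  simp [energyPairing, hy.u, hy.v, hy.uExt, hy.uFault, Segment.pairing, Segment.traction]

lemma energyPairing_of_isZero_right {y z : State sc} (hz : z.IsZero) :
    energyPairing sc y z = 0 := by
  simp [energyPairing, hz.u, hz.v, hz.uExt, hz.uFault, Segment.pairing, Segment.traction]

/-- On an exterior segment the forward and the time-reversed characteristic boundary conditions
are dual to each other: the energy flux vanishes. -/
lemma ext_flux_eq_zero (y z : State sc) (s : Side) (ζ : Fin (sc.blk s).nExt) :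
    ((sc.blk s).ext ζ).flux (y.u s) (y.v s) (y.uExt s ζ) (lStarExt sc 1 y s ζ) (tauExt sc 1 y s ζ)
      (z.u s) (z.v s) (z.uExt s ζ) (-lStarExt sc (-1) z s ζ) (tauExt sc (-1) z s ζ) = 0 := by
  simp only [Segment.flux, ip, ← Finset.sum_add_distrib]
  refine Finset.sum_eq_zero fun i _ => ?_
  have := (zExt_pos sc s ζ i).ne'
  simp only [tauExt, lStarExt, wExt, Pi.sub_apply, Pi.mul_apply, Pi.smul_apply, Pi.neg_apply,
    smul_eq_mul]
  field_simp
  ring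

/-- The energy flux through the two sides of the fault reduces to the antisymmetric pairing of the
fault laws with the slip velocities. -/
lemma sum_fault_flux {Φ Θ : Fin m → ℝ} {y z : State sc}
    (hy : ∀ i, kappa sc i * y.V i + Φ i = -tauEll sc 1 y i)
    (hz : ∀ i, kappa sc i * z.V i + Θ i = -tauEll sc (-1) z i) :
    ∑ s, (sc.blk s).fault.flux (y.u s) (y.v s) (y.uFault s) (lStarFault sc 1 Φ y s)
      (tauFault Φ s) (z.u s) (z.v s) (z.uFault s) (-lStarFault sc (-1) Θ z s) (tauFault Θ s)
      = ip sc.hΓ Φ z.V - ip sc.hΓ Θ y.V := by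
  simp only [Segment.flux, ip, fault_h_eq, Fintype.sum_bool, ← Finset.sum_add_distrib,
    ← Finset.sum_sub_distrib]
  refine Finset.sum_congr rfl fun i _ => ?_
  have hp := (zFault_pos sc true i)
  have hm := (zFault_pos sc false i)
  have hpm := (add_pos hp hm).ne'
  have hk := (kappa_pos sc i).ne'
  have ey : y.V i = (-tauEll sc 1 y i - Φ i) / kappa sc i := by
    rw [← hy]; field_simp; ring
  have ez : z.V i = (-tauEll sc (-1) z i - Θ i) / kappa sc i := by
    rw [← hz]; field_simp; ring
  rw [ey, ez]
  have hp' := hp.ne'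
  have hm' := hm.ne'
  simp only [tauFault, lStarFault, tauEll, wFault, kappa, Pi.sub_apply, Pi.mul_apply,
    Pi.smul_apply, Pi.neg_apply, smul_eq_mul, sgn, if_true, Bool.false_eq_true, if_false]
  field_simp
  ring

lemma posSemidef_dotProduct_comm {n : ℕ} {R : Matrix (Fin n) (Fin n) ℝ} (hR : R.PosSemidef)
    (x y : Fin n → ℝ) : x ⬝ᵥ (R *ᵥ y) = y ⬝ᵥ (R *ᵥ x) := by
  have h : Rᵀ = R := (Matrix.conjTranspose_eq_transpose_of_trivial R).symm.trans hR.isHermitian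
  rw [Matrix.dotProduct_mulVec, ← Matrix.mulVec_transpose, h, dotProduct_comm]

/-- The energy balance of a forward trajectory `y` and an adjoint trajectory `z`, for arbitrary
fault laws and without any momentum equation. -/
lemma hasDerivWithinAt_energyPairing {T : ℝ} {Φ Θ : ℝ → Fin m → ℝ} {y z : ℝ → State sc}
    (hy : FluxLaws sc 1 T Φ y) (hz : FluxLaws sc (-1) T Θ z) {t : ℝ} (ht : t ∈ Icc 0 T)
    {ya za : ∀ s, Fin (sc.blk s).n → ℝ}
    (hya : ∀ s, HasDerivWithinAt (fun r => (y r).v s) (ya s) (Icc 0 T) t)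
    (hza : ∀ s, HasDerivWithinAt (fun r => (z r).v s) (za s) (Icc 0 T) t) :
    HasDerivWithinAt (fun r => energyPairing sc (y r) (z r))
      ((∑ s, ip (sc.blk s).h ((z t).v s) ((sc.blk s).ρ * ya s - opL sc 1 (Φ t) (y t) s))
        + (∑ s, ip (sc.blk s).h ((sc.blk s).ρ * za s - opL sc (-1) (Θ t) (z t) s) ((y t).v s))
        + (ip sc.hΓ (Φ t) (z t).V - ip sc.hΓ (Θ t) (y t).V)) (Icc 0 T) t := by
  rw [← sum_fault_flux (hy.slip t ht) (hz.slip t ht), ← Finset.sum_add_distrib,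
    ← Finset.sum_add_distrib]
  refine HasDerivWithinAt.fun_sum fun s _ => ?_
  have yu := hy.vel t ht s
  have zu := hz.vel t ht s
  have yE : ∀ ζ, HasDerivWithinAt (fun r => (y r).uExt s ζ) (lStarExt sc 1 (y t) s ζ)
      (Icc 0 T) t := fun ζ => by simpa using hy.ext t ht s ζ
  have zE : ∀ ζ, HasDerivWithinAt (fun r => (z r).uExt s ζ) (-lStarExt sc (-1) (z t) s ζ)
      (Icc 0 T) t := fun ζ => by simpa using (hz.ext t ht s ζ).fun_neg
  have yF : HasDerivWithinAt (fun r => (y r).uFault s) (lStarFault sc 1 (Φ t) (y t) s)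
      (Icc 0 T) t := by simpa using hy.fault t ht s
  have zF : HasDerivWithinAt (fun r => (z r).uFault s) (-lStarFault sc (-1) (Θ t) (z t) s)
      (Icc 0 T) t := by simpa using (hz.fault t ht s).fun_neg
  have k1 := hasDerivWithinAt_ip (sc.blk s).h (hza s)
    (hasDerivWithinAt_const_mul_pi (sc.blk s).ρ (hya s))
  have k2 := HasDerivWithinAt.fun_sum (u := Finset.univ) fun (I : Fin 2) _ =>
    hasDerivWithinAt_ip (sc.blk s).h (hasDerivWithinAt_mulVec ((sc.blk s).D1 I) zu)
    (hasDerivWithinAt_const_mul_pi (sc.blk s).μ (hasDerivWithinAt_mulVec ((sc.blk s).D1 I) yu))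
  have k3 : HasDerivWithinAt (fun r => (z r).u s ⬝ᵥ ((sc.blk s).RΔ *ᵥ (y r).u s))
      ((z t).v s ⬝ᵥ ((sc.blk s).RΔ *ᵥ (y t).u s) + (z t).u s ⬝ᵥ ((sc.blk s).RΔ *ᵥ (y t).v s))
      (Icc 0 T) t := by
    simpa [ip, dotProduct] using
      hasDerivWithinAt_ip 1 zu (hasDerivWithinAt_mulVec (sc.blk s).RΔ yu)
  have k4 := HasDerivWithinAt.fun_sum (u := Finset.univ) fun ζ _ =>
    ((sc.blk s).ext ζ).hasDerivWithinAt_pairing yu zu (yE ζ) (zE ζ) (tauExt sc 1 (y t) s ζ)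
      (tauExt sc (-1) (z t) s ζ)
  have k5 := (sc.blk s).fault.hasDerivWithinAt_pairing yu zu yF zF (tauFault (Φ t) s)
      (tauFault (Θ t) s)
  refine ((((k1.add k2).add k3).add k4).add k5).congr_deriv ?_
  simp only [ext_flux_eq_zero, Finset.sum_sub_distrib, Finset.sum_const_zero,
    Finset.sum_add_distrib]
  rw [ip_sub_right, ip_sub_left, ip_opL, ip_comm _ (opL _ _ _ _ _), ip_opL,
    posSemidef_dotProduct_comm (sc.blk s).RΔ_posSemidef ((z t).u s),
    ip_mul_comm _ _ (za s), ip_comm _ ((y t).v s)]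
  rw [Finset.sum_congr rfl fun I _ => ip_mul_comm (sc.blk s).h (sc.blk s).μ
    ((sc.blk s).D1 I *ᵥ (z t).u s) ((sc.blk s).D1 I *ᵥ (y t).v s)]
  ring

end Pairing

/-! ### Linear structure of the semi-discretization -/

/-- A map that respects `c • x + y` is linear. -/
def linearMapOfSMulAdd {E F : Type*} [AddCommGroup E] [Module ℝ E] [AddCommGroup F] [Module ℝ F]
    (f : E → F) (hf : ∀ (c : ℝ) x y, f (c • x + y) = c • f x + f y) : E →ₗ[ℝ] F where
  toFun := f
  map_add' x y := by simpa using hf 1 x y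
  map_smul' c x := by
    have h0 : f 0 = 0 := by simpa using hf 1 0 0
    simpa [h0] using hf c x 0

section SegmentLinear

variable {n k : ℕ} (g : Segment n k)

lemma Segment.traction_smul_add (c : ℝ) (u u' : Fin n → ℝ) :
    g.traction (c • u + u') = c • g.traction u + g.traction u' := by
  simp [Segment.traction, Matrix.mulVec_add, Matrix.mulVec_smul]

lemma Segment.modTraction_smul_add (c : ℝ) (u u' : Fin n → ℝ) (us us' : Fin k → ℝ) :
    g.modTraction (c • u + u') (c • us + us')
      = c • g.modTraction u us + g.modTraction u' us' := by
  ext i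
  simp only [Segment.modTraction, Segment.traction_smul_add, Matrix.mulVec_add,
    Matrix.mulVec_smul, Pi.add_apply, Pi.sub_apply, Pi.mul_apply, Pi.smul_apply, smul_eq_mul]
  ring

lemma Segment.sat_smul_add (hΩ : Fin n → ℝ) (c : ℝ) (u u' : Fin n → ℝ)
    (us us' τs τs' : Fin k → ℝ) :
    g.sat hΩ (c • u + u') (c • us + us') (c • τs + τs')
      = c • g.sat hΩ u us τs + g.sat hΩ u' us' τs' := by
  have h1 : g.h * (c • τs + τs' - g.traction (c • u + u'))
      = c • (g.h * (τs - g.traction u)) + g.h * (τs' - g.traction u') := by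
    ext i
    simp only [Segment.traction_smul_add, Pi.add_apply, Pi.sub_apply, Pi.mul_apply,
      Pi.smul_apply, smul_eq_mul]
    ring
  have h2 : g.h * (c • us + us' - g.e *ᵥ (c • u + u'))
      = c • (g.h * (us - g.e *ᵥ u)) + g.h * (us' - g.e *ᵥ u') := by
    ext i
    simp only [Matrix.mulVec_add, Matrix.mulVec_smul, Pi.add_apply, Pi.sub_apply, Pi.mul_apply,
      Pi.smul_apply, smul_eq_mul]
    ring
  ext i
  simp only [Segment.sat, Pi.add_apply, Pi.smul_apply, smul_eq_mul]
  rw [h1, h2]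
  simp only [Matrix.mulVec_add, Matrix.mulVec_smul, Pi.add_apply, Pi.smul_apply, smul_eq_mul]
  ring

end SegmentLinear

section Vec

variable {m : ℕ} (sc : Scheme m)

/-- The unknowns `(u, u̇, u*)` that enter the semi-discretization linearly: the components of
`State` other than the slip velocity and the state variable. -/
abbrev Vec : Type :=
  (∀ s, Fin (sc.blk s).n → ℝ) × (∀ s, Fin (sc.blk s).n → ℝ)
    × (∀ s ζ, Fin ((sc.blk s).k ζ) → ℝ) × (∀ _ : Side, Fin m → ℝ)

variable {sc}

/-- The linear unknowns of a state. -/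
def State.vec (x : State sc) : Vec sc := (x.u, x.v, x.uExt, x.uFault)

/-- The state with given linear unknowns, at zero slip velocity and zero state variable. -/
def ofVec (w : Vec sc) : State sc := ⟨w.1, w.2.1, w.2.2.1, w.2.2.2, 0, 0⟩

variable (sc) (σ : ℝ)

lemma wExt_smul_add (c : ℝ) (w w' : Vec sc) (s : Side) (ζ : Fin (sc.blk s).nExt) :
    wExt sc σ (ofVec (c • w + w')) s ζ
      = c • wExt sc σ (ofVec w) s ζ + wExt sc σ (ofVec w') s ζ := by
  ext i
  simp only [wExt, ofVec, Prod.fst_add, Prod.snd_add, Prod.smul_fst, Prod.smul_snd, Pi.add_apply,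
    Pi.smul_apply, Segment.modTraction_smul_add, Matrix.mulVec_add, Matrix.mulVec_smul,
    Pi.sub_apply, Pi.mul_apply, smul_eq_mul]
  ring

lemma wFault_smul_add (c : ℝ) (w w' : Vec sc) (s : Side) :
    wFault sc σ (ofVec (c • w + w')) s
      = c • wFault sc σ (ofVec w) s + wFault sc σ (ofVec w') s := by
  ext i
  simp only [wFault, ofVec, Prod.fst_add, Prod.snd_add, Prod.smul_fst, Prod.smul_snd,
    Pi.add_apply, Pi.smul_apply, Segment.modTraction_smul_add, Matrix.mulVec_add,
    Matrix.mulVec_smul, Pi.sub_apply, Pi.mul_apply, smul_eq_mul]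
  ring

lemma tauExt_smul_add (c : ℝ) (w w' : Vec sc) (s : Side) (ζ : Fin (sc.blk s).nExt) :
    tauExt sc σ (ofVec (c • w + w')) s ζ
      = c • tauExt sc σ (ofVec w) s ζ + tauExt sc σ (ofVec w') s ζ := by
  ext i
  simp only [tauExt, wExt_smul_add, Pi.add_apply, Pi.smul_apply, smul_eq_mul]
  ring

lemma tauFault_smul_add (c : ℝ) (Φ Φ' : Fin m → ℝ) (s : Side) :
    tauFault (c • Φ + Φ') s = c • tauFault Φ s + tauFault Φ' s := by
  ext i
  simp only [tauFault, Pi.add_apply, Pi.smul_apply, smul_eq_mul]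
  ring

/-- `opL` as a linear function of the linear unknowns and the value of the fault law. -/
def opLLin : Vec sc × (Fin m → ℝ) →ₗ[ℝ] (∀ s, Fin (sc.blk s).n → ℝ) :=
  linearMapOfSMulAdd (fun a => opL sc σ a.2 (ofVec a.1)) <| by
    intro c a b
    funext s
    simp only [opL, Prod.fst_add, Prod.snd_add, Prod.smul_fst, Prod.smul_snd, tauExt_smul_add,
      tauFault_smul_add, Pi.add_apply, Pi.smul_apply]
    simp only [ofVec, Prod.fst_add, Prod.snd_add, Prod.smul_fst, Prod.smul_snd, Pi.add_apply,
      Pi.smul_apply, Segment.sat_smul_add, Matrix.mulVec_add, Matrix.mulVec_smul,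
      Finset.sum_add_distrib, ← Finset.smul_sum, smul_add]
    abel

/-- `tauEll` as a linear function of the linear unknowns. -/
def tauEllLin : Vec sc →ₗ[ℝ] (Fin m → ℝ) :=
  linearMapOfSMulAdd (fun w => tauEll sc σ (ofVec w)) <| by
    intro c w w'
    ext i
    simp only [tauEll, wFault_smul_add, Pi.add_apply, Pi.smul_apply, smul_eq_mul]
    ring

/-- The time derivative of the linear unknowns in the forward scheme. -/
def forwardRate (x : State sc) (Φ : Fin m → ℝ) : Vec sc :=
  (x.v, fun s i => ((sc.blk s).ρ i)⁻¹ * opL sc 1 Φ x s i, lStarExt sc 1 x, lStarFault sc 1 Φ x)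

/-- `forwardRate` as a linear function of the linear unknowns and the value of the fault law. -/
def forwardRateLin : Vec sc × (Fin m → ℝ) →ₗ[ℝ] Vec sc :=
  linearMapOfSMulAdd (fun a => forwardRate sc (ofVec a.1) a.2) <| by
    intro c a b
    have h := (opLLin sc 1).map_add (c • a) b
    rw [map_smul] at h
    refine Prod.ext rfl (Prod.ext ?_ (Prod.ext ?_ ?_))
    · funext s i
      have := congrFun (congrFun h s) i
      change _ * (opLLin sc 1 (c • a + b)) s i
        = c * (_ * (opLLin sc 1 a) s i) + _ * (opLLin sc 1 b) s i
      rw [this, Pi.add_apply, Pi.smul_apply, Pi.add_apply, Pi.smul_apply, smul_eq_mul]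
      ring
    · funext s ζ i
      simp only [forwardRate, lStarExt, ofVec, Prod.fst_add, Prod.snd_add, Prod.smul_fst,
        Prod.smul_snd, Pi.add_apply, Pi.smul_apply, Segment.modTraction_smul_add,
        Matrix.mulVec_add, Matrix.mulVec_smul, smul_eq_mul]
      ring
    · funext s i
      simp only [forwardRate, lStarFault, tauFault_smul_add, ofVec, Prod.fst_add, Prod.snd_add,
        Prod.smul_fst, Prod.smul_snd, Pi.add_apply, Pi.smul_apply, Segment.modTraction_smul_add,
        Matrix.mulVec_add, Matrix.mulVec_smul, smul_eq_mul]
      ring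

variable {sc}

lemma opL_eq (x : State sc) (Φ : Fin m → ℝ) : opL sc σ Φ x = opLLin sc σ (x.vec, Φ) := rfl

lemma tauEll_eq (x : State sc) : tauEll sc σ x = tauEllLin sc σ x.vec := rfl

lemma forwardRate_eq (x : State sc) (Φ : Fin m → ℝ) :
    forwardRate sc x Φ = forwardRateLin sc (x.vec, Φ) := rfl

/-- The componentwise difference of two states. -/
def State.diff (x y : State sc) : State sc :=
  ⟨x.u - y.u, x.v - y.v, x.uExt - y.uExt, x.uFault - y.uFault, x.V - y.V, x.Ψ - y.Ψ⟩

lemma State.vec_diff (x y : State sc) : (x.diff y).vec = x.vec - y.vec := rfl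

/-- Flux laws and momentum equation combined: the linear unknowns evolve at the rate
`forwardRate`. -/
lemma FluxLaws.hasDerivWithinAt_vec {T : ℝ} {Φ : ℝ → Fin m → ℝ} {y : ℝ → State sc}
    (hy : FluxLaws sc 1 T Φ y) {t : ℝ} (ht : t ∈ Icc 0 T)
    (hv : ∀ s, HasDerivWithinAt (fun r => (y r).v s)
      (fun i => ((sc.blk s).ρ i)⁻¹ * opL sc 1 (Φ t) (y t) s i) (Icc 0 T) t) :
    HasDerivWithinAt (fun r => (y r).vec) (forwardRate sc (y t) (Φ t)) (Icc 0 T) t := by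
  refine HasDerivWithinAt.prodMk (hasDerivWithinAt_pi.2 fun s => hy.vel t ht s)
    (HasDerivWithinAt.prodMk (hasDerivWithinAt_pi.2 hv) (HasDerivWithinAt.prodMk
      (hasDerivWithinAt_pi.2 fun s => hasDerivWithinAt_pi.2 fun ζ => ?_)
      (hasDerivWithinAt_pi.2 fun s => ?_)))
  · simpa using hy.ext t ht s ζ
  · simpa using hy.fault t ht s

lemma FluxLaws.continuousOn_vec {T : ℝ} {Φ : ℝ → Fin m → ℝ} {y : ℝ → State sc} {σ : ℝ}
    (hσ : σ ≠ 0) (hy : FluxLaws sc σ T Φ y)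
    (hv : ∀ s, ContinuousOn (fun r => (y r).v s) (Icc 0 T)) :
    ContinuousOn (fun r => (y r).vec) (Icc 0 T) := by
  have cancel : ∀ {k : ℕ} {f : ℝ → Fin k → ℝ} {t : ℝ},
      ContinuousWithinAt (fun r => σ • f r) (Icc 0 T) t → ContinuousWithinAt f (Icc 0 T) t := by
    intro k f t h
    simpa [Pi.smul_def, smul_smul, hσ] using h.const_smul σ⁻¹
  refine ContinuousOn.prodMk (continuousOn_pi.2 fun s t ht => (hy.vel t ht s).continuousWithinAt)
    (ContinuousOn.prodMk (continuousOn_pi.2 hv) (ContinuousOn.prodMk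
      (continuousOn_pi.2 fun s => continuousOn_pi.2 fun ζ t ht =>
        cancel (hy.ext t ht s ζ).continuousWithinAt)
      (continuousOn_pi.2 fun s t ht => cancel (hy.fault t ht s).continuousWithinAt)))

/-- The flux laws are linear in the unknowns and the fault law together. -/
lemma FluxLaws.diff {T : ℝ} {Φ Φ' : ℝ → Fin m → ℝ} {y y' : ℝ → State sc}
    (hy : FluxLaws sc 1 T Φ y) (hy' : FluxLaws sc 1 T Φ' y') :
    FluxLaws sc 1 T (fun t => Φ t - Φ' t) (fun t => (y t).diff (y' t)) where
  vel t ht s := (hy.vel t ht s).sub (hy'.vel t ht s)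
  ext t ht s ζ := by
    have h : lStarExt sc 1 ((y t).diff (y' t))
        = lStarExt sc 1 (y t) - lStarExt sc 1 (y' t) :=
      congrArg (fun a : Vec sc => a.2.2.1)
        ((forwardRateLin sc).map_sub ((y t).vec, Φ t) ((y' t).vec, Φ' t))
    rw [h]
    simpa [State.diff] using (hy.ext t ht s ζ).fun_sub (hy'.ext t ht s ζ)
  fault t ht s := by
    have h : lStarFault sc 1 (Φ t - Φ' t) ((y t).diff (y' t))
        = lStarFault sc 1 (Φ t) (y t) - lStarFault sc 1 (Φ' t) (y' t) :=
      congrArg (fun a : Vec sc => a.2.2.2)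
        ((forwardRateLin sc).map_sub ((y t).vec, Φ t) ((y' t).vec, Φ' t))
    rw [h]
    simpa [State.diff] using (hy.fault t ht s).fun_sub (hy'.fault t ht s)
  slip t ht i := by
    have h : tauEll sc 1 ((y t).diff (y' t)) = tauEll sc 1 (y t) - tauEll sc 1 (y' t) :=
      (tauEllLin sc 1).map_sub (y t).vec (y' t).vec
    have h1 := hy.slip t ht i
    have h2 := hy'.slip t ht i
    rw [h]
    simp only [State.diff, Pi.sub_apply]
    linarith

lemma exists_norm_map_le {E F : Type*} [NormedAddCommGroup E] [NormedSpace ℝ E]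
    [FiniteDimensional ℝ E] [NormedAddCommGroup F] [NormedSpace ℝ F] (f : E →ₗ[ℝ] F) :
    ∃ C, 0 ≤ C ∧ ∀ x, ‖f x‖ ≤ C * ‖x‖ :=
  ⟨_, norm_nonneg _, (LinearMap.toContinuousLinearMap f).le_opNorm⟩

end Vec

/-! ### Uniform linearization of the fault laws along a trajectory -/

section Linearization

/-- A `C¹` function is differentiable uniformly along a compact set of base points. -/
lemma exists_uniform_linearization {E : Type*} [NormedAddCommGroup E] [NormedSpace ℝ E]
    {f : E → ℝ} {K : Set E} (hK : IsCompact K) (hf : ∀ z ∈ K, ContDiffAt ℝ 1 f z) {ε : ℝ}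
    (hε : 0 < ε) :
    ∃ δ > 0, ∀ h : E, ‖h‖ ≤ δ → ∀ z ∈ K, |f (z + h) - f z - fderiv ℝ f z h| ≤ ε * ‖h‖ := by
  have key : ∀ᶠ h in 𝓝 (0 : E), ∀ z ∈ K, |f (z + h) - f z - fderiv ℝ f z h| ≤ ε * ‖h‖ := by
    refine hK.eventually_forall_of_forall_eventually fun z₀ hz₀ => ?_
    have h1 := ((hf z₀ hz₀).hasStrictFDerivAt one_ne_zero).isLittleO.bound (half_pos hε)
    have h2 : ∀ᶠ z in 𝓝 z₀, ‖fderiv ℝ f z - fderiv ℝ f z₀‖ ≤ ε / 2 := by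
      have := ((hf z₀ hz₀).continuousAt_fderiv one_ne_zero).sub_const (fderiv ℝ f z₀)
      have := Filter.Tendsto.eventually_le_const (u := ε / 2) (by simpa using half_pos hε) this.norm
      simpa using this
    have t1 : Tendsto (fun a : E × E => (a.2 + a.1, a.2)) (𝓝 (0, z₀)) (𝓝 (z₀, z₀)) := by
      have : ContinuousAt (fun a : E × E => (a.2 + a.1, a.2)) (0, z₀) := by fun_prop
      simpa [ContinuousAt] using this
    have t2 : Tendsto (fun a : E × E => a.2) (𝓝 (0, z₀)) (𝓝 z₀) := continuousAt_snd
    filter_upwards [t1.eventually h1, t2.eventually h2] with ⟨h, z⟩ a1 a2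
    simp only [add_sub_cancel_left, Real.norm_eq_abs] at a1 a2 ⊢
    have a3 := (fderiv ℝ f z - fderiv ℝ f z₀).le_of_opNorm_le a2 h
    rw [sub_apply, Real.norm_eq_abs] at a3
    rw [abs_le] at *
    constructor <;> linarith [a1.1, a1.2, a3.1, a3.2]
  obtain ⟨δ, hδ, h⟩ := Metric.eventually_nhds_iff.1 key
  exact ⟨δ / 2, half_pos hδ, fun x hx => h (by rw [dist_zero_right]; linarith)⟩

lemma fderiv_eq_partials {f : ℝ × ℝ × ℝ → ℝ} {V Ψ q : ℝ} (hf : ContDiffAt ℝ 1 f (V, Ψ, q))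
    (a b c : ℝ) :
    fderiv ℝ f (V, Ψ, q) (a, b, c) = deriv (fun y => f (y, Ψ, q)) V * a
      + deriv (fun y => f (V, y, q)) Ψ * b + deriv (fun y => f (V, Ψ, y)) q * c := by
  have hd := (hf.differentiableAt one_ne_zero).hasFDerivAt
  have h1 : HasDerivAt (fun y => f (y, Ψ, q)) (fderiv ℝ f (V, Ψ, q) (1, 0, 0)) V :=
    hd.comp_hasDerivAt (f := fun y => (y, Ψ, q)) V
      ((hasDerivAt_id V).prodMk (hasDerivAt_const V (Ψ, q)))
  have h2 : HasDerivAt (fun y => f (V, y, q)) (fderiv ℝ f (V, Ψ, q) (0, 1, 0)) Ψ :=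
    hd.comp_hasDerivAt (f := fun y => (V, y, q)) Ψ
      ((hasDerivAt_const Ψ V).prodMk ((hasDerivAt_id Ψ).prodMk (hasDerivAt_const Ψ q)))
  have h3 : HasDerivAt (fun y => f (V, Ψ, y)) (fderiv ℝ f (V, Ψ, q) (0, 0, 1)) q :=
    hd.comp_hasDerivAt (f := fun y => (V, Ψ, y)) q
      ((hasDerivAt_const q V).prodMk ((hasDerivAt_const q Ψ).prodMk (hasDerivAt_id q)))
  have e : ((a, b, c) : ℝ × ℝ × ℝ)
      = a • ((1, 0, 0) : ℝ × ℝ × ℝ) + b • ((0, 1, 0) : ℝ × ℝ × ℝ)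
        + c • ((0, 0, 1) : ℝ × ℝ × ℝ) := by simp
  rw [h1.deriv, h2.deriv, h3.deriv, e]
  simp only [map_add, map_smul, smul_eq_mul]
  ring

variable {m : ℕ} {sc : Scheme m}

/-- The law is continuously differentiable near every point that the trajectory `X` visits at the
times in `S`. -/
def FaultLaw.IsC1Along (F : FaultLaw m) (p : Fin m → ℝ) (X : ℝ → State sc) (S : Set ℝ) : Prop :=
  ∀ t ∈ S, ∀ i, ContDiffAt ℝ 1 (fun z : ℝ × ℝ × ℝ => F i z.1 z.2.1 z.2.2)
    ((X t).V i, (X t).Ψ i, p i)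

/-- The first-order Taylor polynomial, without constant term, of a law at `(x, p)`. -/
def FaultLaw.taylor (F : FaultLaw m) (p : Fin m → ℝ) (x : State sc) (i : Fin m) (a b c : ℝ) : ℝ :=
  F.dV p x i * a + F.dΨ p x i * b + F.dp p x i * c

variable {F : FaultLaw m} {p : Fin m → ℝ} {X : ℝ → State sc} {S : Set ℝ}

lemma FaultLaw.IsC1Along.continuousOn_fderiv (hF : F.IsC1Along p X S)
    (hV : ContinuousOn (fun t => (X t).V) S) (hΨ : ContinuousOn (fun t => (X t).Ψ) S)
    (i : Fin m) :
    ContinuousOn (fun t => fderiv ℝ (fun z : ℝ × ℝ × ℝ => F i z.1 z.2.1 z.2.2)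
      ((X t).V i, (X t).Ψ i, p i)) S := by
  intro t ht
  have hc : ContinuousWithinAt (fun t => ((X t).V i, (X t).Ψ i, p i)) S t :=
    ((continuousOn_pi.1 hV i) t ht).prodMk
      (((continuousOn_pi.1 hΨ i) t ht).prodMk continuousWithinAt_const)
  exact ((hF t ht i).continuousAt_fderiv one_ne_zero).comp_continuousWithinAt
    (f := fun t => ((X t).V i, (X t).Ψ i, p i)) hc

lemma FaultLaw.IsC1Along.taylor_eq (hF : F.IsC1Along p X S) {t : ℝ} (ht : t ∈ S) (i : Fin m)
    (a b c : ℝ) : F.taylor p (X t) i a b c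
      = fderiv ℝ (fun z : ℝ × ℝ × ℝ => F i z.1 z.2.1 z.2.2) ((X t).V i, (X t).Ψ i, p i)
        (a, b, c) :=
  (fderiv_eq_partials (hF t ht i) a b c).symm

lemma FaultLaw.IsC1Along.continuousOn_taylor (hF : F.IsC1Along p X S)
    (hV : ContinuousOn (fun t => (X t).V) S) (hΨ : ContinuousOn (fun t => (X t).Ψ) S)
    (i : Fin m) (a b c : ℝ) : ContinuousOn (fun t => F.taylor p (X t) i a b c) S :=
  ((hF.continuousOn_fderiv hV hΨ i).clm_apply (continuousOn_const (c := (a, b, c)))).congr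
    fun _ ht => hF.taylor_eq ht i a b c

lemma FaultLaw.IsC1Along.continuousOn_dV (hF : F.IsC1Along p X S)
    (hV : ContinuousOn (fun t => (X t).V) S) (hΨ : ContinuousOn (fun t => (X t).Ψ) S) :
    ContinuousOn (fun t => F.dV p (X t)) S :=
  continuousOn_pi.2 fun i => by
    simpa [FaultLaw.taylor] using hF.continuousOn_taylor hV hΨ i 1 0 0

lemma FaultLaw.IsC1Along.continuousOn_dΨ (hF : F.IsC1Along p X S)
    (hV : ContinuousOn (fun t => (X t).V) S) (hΨ : ContinuousOn (fun t => (X t).Ψ) S) :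
    ContinuousOn (fun t => F.dΨ p (X t)) S :=
  continuousOn_pi.2 fun i => by
    simpa [FaultLaw.taylor] using hF.continuousOn_taylor hV hΨ i 0 1 0

lemma FaultLaw.IsC1Along.continuousOn_dp (hF : F.IsC1Along p X S)
    (hV : ContinuousOn (fun t => (X t).V) S) (hΨ : ContinuousOn (fun t => (X t).Ψ) S) :
    ContinuousOn (fun t => F.dp p (X t)) S :=
  continuousOn_pi.2 fun i => by
    simpa [FaultLaw.taylor] using hF.continuousOn_taylor hV hΨ i 0 0 1

/-- The Taylor remainder of a law is small uniformly along a trajectory on a compact set of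
times. -/
lemma FaultLaw.IsC1Along.exists_taylor_bound (hF : F.IsC1Along p X S) (hS : IsCompact S)
    (hV : ContinuousOn (fun t => (X t).V) S) (hΨ : ContinuousOn (fun t => (X t).Ψ) S)
    {ε : ℝ} (hε : 0 < ε) :
    ∃ δ > 0, ∀ d ≤ δ, ∀ t ∈ S, ∀ i, ∀ V' Ψ' q : ℝ, |V' - (X t).V i| ≤ d →
      |Ψ' - (X t).Ψ i| ≤ d → |q - p i| ≤ d →
      |F i V' Ψ' q - F i ((X t).V i) ((X t).Ψ i) (p i)
        - F.taylor p (X t) i (V' - (X t).V i) (Ψ' - (X t).Ψ i) (q - p i)| ≤ ε * d := by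
  have h1 : ∀ i, ∃ δ > 0, ∀ h : ℝ × ℝ × ℝ, ‖h‖ ≤ δ →
      ∀ z ∈ (fun t => ((X t).V i, (X t).Ψ i, p i)) '' S,
      |F i (z + h).1 (z + h).2.1 (z + h).2.2 - F i z.1 z.2.1 z.2.2
        - fderiv ℝ (fun z : ℝ × ℝ × ℝ => F i z.1 z.2.1 z.2.2) z h| ≤ ε * ‖h‖ := fun i =>
    exists_uniform_linearization (f := fun z : ℝ × ℝ × ℝ => F i z.1 z.2.1 z.2.2)
      (hS.image_of_continuousOn ((continuousOn_pi.1 hV i).prodMk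
        ((continuousOn_pi.1 hΨ i).prodMk continuousOn_const)))
      (by rintro _ ⟨t, ht, rfl⟩; exact hF t ht i) hε
  choose δ hδ h using h1
  obtain ⟨δ₀, hδ₀, hle⟩ : ∃ δ₀ > 0, ∀ i, δ₀ ≤ δ i := by
    have : ∀ᶠ x in 𝓝[>] (0 : ℝ), ∀ i, x ≤ δ i :=
      eventually_all.2 fun i => eventually_nhdsWithin_of_eventually_nhds
        (eventually_le_nhds (hδ i))
    obtain ⟨x, hx, hx0⟩ := (this.and self_mem_nhdsWithin).exists
    exact ⟨x, hx0, hx⟩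
  refine ⟨δ₀, hδ₀, fun d hd t ht i V' Ψ' q h1 h2 h3 => ?_⟩
  have hn : ‖(V' - (X t).V i, Ψ' - (X t).Ψ i, q - p i)‖ ≤ d := by
    simp only [Prod.norm_def, Real.norm_eq_abs, sup_le_iff]
    exact ⟨h1, h2, h3⟩
  have := h i _ (hn.trans (hd.trans (hle i))) _ ⟨t, ht, rfl⟩
  rw [hF.taylor_eq ht]
  simp only [Prod.fst_add, Prod.snd_add, add_sub_cancel] at this
  exact this.trans (mul_le_mul_of_nonneg_left hn hε.le)

/-- The laws are Lipschitz uniformly in a tube around a trajectory on a compact set of times. -/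
lemma FaultLaw.IsC1Along.exists_lipschitz_bound (hF : F.IsC1Along p X S) (hS : IsCompact S)
    (hV : ContinuousOn (fun t => (X t).V) S) (hΨ : ContinuousOn (fun t => (X t).Ψ) S) :
    ∃ L ≥ 0, ∃ δ > 0, ∀ d ≤ δ, ∀ t ∈ S, ∀ i, ∀ V' Ψ' q : ℝ, |V' - (X t).V i| ≤ d →
      |Ψ' - (X t).Ψ i| ≤ d → |q - p i| ≤ d →
      |F i V' Ψ' q - F i ((X t).V i) ((X t).Ψ i) (p i)| ≤ L * d := by
  obtain ⟨δ, hδ, h⟩ := hF.exists_taylor_bound hS hV hΨ one_pos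
  obtain ⟨A, hA⟩ := hS.exists_bound_of_continuousOn (hF.continuousOn_dV hV hΨ)
  obtain ⟨B, hB⟩ := hS.exists_bound_of_continuousOn (hF.continuousOn_dΨ hV hΨ)
  obtain ⟨C, hC⟩ := hS.exists_bound_of_continuousOn (hF.continuousOn_dp hV hΨ)
  refine ⟨|A| + |B| + |C| + 1, by positivity, δ, hδ, fun d hd t ht i V' Ψ' q h1 h2 h3 => ?_⟩
  have k := h d hd t ht i V' Ψ' q h1 h2 h3
  have a := mul_le_mul (((norm_le_pi_norm _ i).trans (hA t ht)).trans (le_abs_self A)) h1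
    (abs_nonneg _) (abs_nonneg _)
  have b := mul_le_mul (((norm_le_pi_norm _ i).trans (hB t ht)).trans (le_abs_self B)) h2
    (abs_nonneg _) (abs_nonneg _)
  have c := mul_le_mul (((norm_le_pi_norm _ i).trans (hC t ht)).trans (le_abs_self C)) h3
    (abs_nonneg _) (abs_nonneg _)
  rw [Real.norm_eq_abs, ← abs_mul] at a b c
  simp only [FaultLaw.taylor] at k
  rw [abs_le] at *
  constructor <;> linarith [a.1, a.2, b.1, b.2, c.1, c.2, k.1, k.2]

end Linearization

/-! ### The slip velocity -/

section Slip

variable {m : ℕ} {sc : Scheme m}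

/-- The slip law `κ V + φ V = α` with a monotone law `φ` determines `V` stably, without any
assumption on the distance of the two slip velocities. -/
lemma slip_stability {κ a b α β γ : ℝ} (hκ : 0 < κ) {φ : ℝ → ℝ} (hφ : Monotone φ)
    (ha : κ * a + φ a = α) (hb : κ * b + β = γ) : |a - b| ≤ κ⁻¹ * (|α - γ| + |φ b - β|) := by
  rw [inv_mul_eq_div, le_div_iff₀ hκ]
  rcases le_total b a with h | h
  · have := hφ h
    rw [abs_of_nonneg (sub_nonneg.2 h)]
    linarith [le_abs_self (α - γ), neg_abs_le (φ b - β)]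
  · have := hφ h
    rw [abs_of_nonpos (sub_nonpos.2 h)]
    linarith [neg_abs_le (α - γ), le_abs_self (φ b - β)]

lemma continuousOn_tauEll {σ : ℝ} {y : ℝ → State sc} {S : Set ℝ}
    (hy : ContinuousOn (fun t => (y t).vec) S) : ContinuousOn (fun t => tauEll sc σ (y t)) S := by
  simp_rw [tauEll_eq]
  exact (tauEllLin sc σ).continuous_of_finiteDimensional.comp_continuousOn hy

lemma continuousOn_opL {σ : ℝ} {y : ℝ → State sc} {Φ : ℝ → Fin m → ℝ} {S : Set ℝ}
    (hy : ContinuousOn (fun t => (y t).vec) S) (hΦ : ContinuousOn Φ S) (s : Side) :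
    ContinuousOn (fun t => opL sc σ (Φ t) (y t) s) S := by
  simp_rw [opL_eq]
  exact continuousOn_pi.1
    ((opLLin sc σ).continuous_of_finiteDimensional.comp_continuousOn (hy.prodMk hΦ)) s

/-- For a friction law that is increasing in the slip velocity, the slip velocity is a continuous
function of time. -/
lemma continuousOn_slip {F : FaultLaw m} {p : Fin m → ℝ} {X : ℝ → State sc} {T : ℝ}
    (hmono : ∀ i Ψ, Monotone fun V => F i V Ψ (p i)) (hF : F.IsC1Along p X (Icc 0 T))
    (hX : FluxLaws sc 1 T (fun t => F.eval p (X t)) X)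
    (hvec : ContinuousOn (fun t => (X t).vec) (Icc 0 T))
    (hΨ : ContinuousOn (fun t => (X t).Ψ) (Icc 0 T)) :
    ContinuousOn (fun t => (X t).V) (Icc 0 T) := by
  refine continuousOn_pi.2 fun i t₀ ht₀ => ?_
  have c1 : ContinuousWithinAt (fun t => F i ((X t₀).V i) ((X t).Ψ i) (p i)) (Icc 0 T) t₀ :=
    (hF t₀ ht₀ i).continuousAt.comp_continuousWithinAt
      (f := fun t => ((X t₀).V i, (X t).Ψ i, p i))
      (continuousWithinAt_const.prodMk
        (((continuousOn_pi.1 hΨ i) t₀ ht₀).prodMk continuousWithinAt_const))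
  have c2 := (continuousOn_pi.1 (continuousOn_tauEll (σ := 1) hvec) i) t₀ ht₀
  rw [ContinuousWithinAt, tendsto_iff_dist_tendsto_zero]
  have lim : Tendsto (fun t => (kappa sc i)⁻¹ * (|-tauEll sc 1 (X t) i - -tauEll sc 1 (X t₀) i|
      + |F i ((X t₀).V i) ((X t).Ψ i) (p i) - F i ((X t₀).V i) ((X t₀).Ψ i) (p i)|))
      (𝓝[Icc 0 T] t₀) (𝓝 0) := by
    have := (((c2.neg.sub continuousWithinAt_const).abs.add
      (c1.sub continuousWithinAt_const).abs).const_mul (kappa sc i)⁻¹ :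
      ContinuousWithinAt (fun t => (kappa sc i)⁻¹ * (|-tauEll sc 1 (X t) i -
        -tauEll sc 1 (X t₀) i| + |F i ((X t₀).V i) ((X t).Ψ i) (p i)
        - F i ((X t₀).V i) ((X t₀).Ψ i) (p i)|)) (Icc 0 T) t₀)
    simpa [ContinuousWithinAt] using this
  refine squeeze_zero' (Eventually.of_forall fun _ => dist_nonneg) ?_ lim
  filter_upwards [self_mem_nhdsWithin] with t ht
  exact slip_stability (kappa_pos sc i) (hmono i ((X t).Ψ i)) (hX.slip t ht i) (hX.slip t₀ ht₀ i)

/-- For a linear fault law with positive coefficient, the slip velocity is a continuous function of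
time. -/
lemma continuousOn_slip_linear {σ T : ℝ} {c g : ℝ → Fin m → ℝ} {y : ℝ → State sc}
    (hy : FluxLaws sc σ T (fun t => c t * (y t).V + g t) y)
    (hc : ContinuousOn c (Icc 0 T)) (hg : ContinuousOn g (Icc 0 T))
    (hpos : ∀ t ∈ Icc 0 T, ∀ i, 0 < c t i)
    (hvec : ContinuousOn (fun t => (y t).vec) (Icc 0 T)) :
    ContinuousOn (fun t => (y t).V) (Icc 0 T) := by
  refine continuousOn_pi.2 fun i => ?_
  have hne : ∀ t ∈ Icc 0 T, kappa sc i + c t i ≠ 0 := fun t ht =>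
    (add_pos (kappa_pos sc i) (hpos t ht i)).ne'
  have h : ContinuousOn (fun t => (-tauEll sc σ (y t) i - g t i) / (kappa sc i + c t i))
      (Icc 0 T) :=
    ((continuousOn_pi.1 (continuousOn_tauEll hvec) i).neg.sub (continuousOn_pi.1 hg i)).div
      (continuousOn_const.add (continuousOn_pi.1 hc i)) hne
  refine h.congr fun t ht => ?_
  rw [eq_div_iff (hne t ht)]
  have := hy.slip t ht i
  simp only [Pi.add_apply, Pi.mul_apply] at this
  linarith

end Slip

/-! ### Stability of the forward scheme -/

section Stability

variable {m : ℕ} {sc : Scheme m} {T : ℝ} {F G : FaultLaw m}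
  {u0 v0 : ∀ s, Fin (sc.blk s).n → ℝ} {p Ψ0 p' Ψ0' : Fin m → ℝ} {X X' : ℝ → State sc}

lemma IsForward.hasDerivWithinAt_vec (hX : IsForward sc T F G u0 v0 p Ψ0 X) {t : ℝ}
    (ht : t ∈ Icc 0 T) : HasDerivWithinAt (fun r => (X r).vec)
      (forwardRate sc (X t) (F.eval p (X t))) (Icc 0 T) t :=
  hX.flux.hasDerivWithinAt_vec ht (hX.momentum t ht)

lemma IsForward.continuousOn_vec (hX : IsForward sc T F G u0 v0 p Ψ0 X) :
    ContinuousOn (fun t => (X t).vec) (Icc 0 T) := fun _ ht =>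
  (hX.hasDerivWithinAt_vec ht).continuousWithinAt

lemma IsForward.continuousOn_Ψ (hX : IsForward sc T F G u0 v0 p Ψ0 X) :
    ContinuousOn (fun t => (X t).Ψ) (Icc 0 T) := fun t ht =>
  (hX.state t ht).continuousWithinAt

lemma IsForward.vec_zero (hX : IsForward sc T F G u0 v0 p Ψ0 X) :
    (X 0).vec = (u0, v0, fun s ζ => ((sc.blk s).ext ζ).e *ᵥ u0 s,
      fun s => (sc.blk s).fault.e *ᵥ u0 s) :=
  Prod.ext (funext hX.init_u) (Prod.ext (funext hX.init_v)
    (Prod.ext (funext fun s => funext (hX.init_uExt s)) (funext hX.init_uFault)))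

lemma exists_kappa_bound (sc : Scheme m) :
    ∃ M, 0 ≤ M ∧ ∀ i, (kappa sc i)⁻¹ ≤ M ∧ kappa sc i ≤ M := by
  refine ⟨∑ i, ((kappa sc i)⁻¹ + kappa sc i), Finset.sum_nonneg fun i _ => ?_, fun i => ?_⟩
  · have := kappa_pos sc i
    positivity
  · have h := Finset.single_le_sum (f := fun i => (kappa sc i)⁻¹ + kappa sc i)
      (fun i _ => by have := kappa_pos sc i; positivity) (Finset.mem_univ i)
    have h1 := kappa_pos sc i
    have h2 := inv_pos.2 h1
    constructor <;> linarith

/-- A bound for the slip velocity and for the value of the friction law in terms of the other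
unknowns, at one time and close to the base trajectory. No bound on the perturbed slip velocity is
assumed. -/
lemma exists_slip_bound (hS : IsCompact (Icc 0 T)) (hF : F.IsC1Along p X (Icc 0 T))
    (hX : FluxLaws sc 1 T (fun t => F.eval p (X t)) X)
    (hV : ContinuousOn (fun t => (X t).V) (Icc 0 T))
    (hΨ : ContinuousOn (fun t => (X t).Ψ) (Icc 0 T)) :
    ∃ C ≥ 1, ∃ δ > 0, ∀ d, 0 ≤ d → d ≤ δ → ∀ p' : Fin m → ℝ, ∀ X' : ℝ → State sc,
      FluxLaws sc 1 T (fun t => F.eval p' (X' t)) X' →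
      (∀ i Ψ, Monotone fun V => F i V Ψ (p' i)) → ‖p' - p‖ ≤ d →
      ∀ t ∈ Icc 0 T, ‖(X' t).vec - (X t).vec‖ ≤ d → ‖(X' t).Ψ - (X t).Ψ‖ ≤ d →
        ‖(X' t).V - (X t).V‖ ≤ C * d ∧ ‖F.eval p' (X' t) - F.eval p (X t)‖ ≤ C * d := by
  obtain ⟨L, hL, δ, hδ, hLip⟩ := hF.exists_lipschitz_bound hS hV hΨ
  obtain ⟨Cτ, hCτ, hτ⟩ := exists_norm_map_le (tauEllLin sc 1)
  obtain ⟨M, hM, hκ⟩ := exists_kappa_bound sc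
  have hMA : 0 ≤ M * (Cτ + L) := by positivity
  have hMM : 0 ≤ M * (M * (Cτ + L)) := by positivity
  refine ⟨1 + M * (Cτ + L) + (M * (M * (Cτ + L)) + Cτ), by linarith, δ, hδ,
    fun d hd hdδ p' X' hX' hmono hp t ht hw hψ => ?_⟩
  have e1 : ∀ i, |tauEll sc 1 (X' t) i - tauEll sc 1 (X t) i| ≤ Cτ * d := fun i => by
    have := norm_le_pi_norm (tauEllLin sc 1 ((X' t).vec - (X t).vec)) i
    rw [map_sub, Pi.sub_apply, Real.norm_eq_abs, ← tauEll_eq, ← tauEll_eq] at this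
    refine this.trans ?_
    have h := hτ ((X' t).vec - (X t).vec)
    rw [map_sub, ← tauEll_eq, ← tauEll_eq] at h
    exact h.trans (mul_le_mul_of_nonneg_left hw hCτ)
  have e2 : ∀ i, |(X' t).V i - (X t).V i| ≤ M * (Cτ + L) * d := fun i => by
    have h := slip_stability (kappa_pos sc i) (hmono i ((X' t).Ψ i)) (hX'.slip t ht i)
      (hX.slip t ht i)
    have h2 := hLip d hdδ t ht i ((X t).V i) ((X' t).Ψ i) (p' i) (by simpa using hd)
      ((norm_le_pi_norm ((X' t).Ψ - (X t).Ψ) i).trans hψ)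
      ((norm_le_pi_norm (p' - p) i).trans hp)
    have h3 : |-tauEll sc 1 (X' t) i - -tauEll sc 1 (X t) i| ≤ Cτ * d := by
      rw [neg_sub_neg, abs_sub_comm]; exact e1 i
    calc _ ≤ _ := h
      _ ≤ M * (Cτ * d + L * d) :=
        mul_le_mul (hκ i).1 (add_le_add h3 h2) (by positivity) hM
      _ = _ := by ring
  have hCτd : 0 ≤ Cτ * d := by positivity
  have hMAd : 0 ≤ M * (Cτ + L) * d := by positivity
  have hMMd : 0 ≤ M * (M * (Cτ + L)) * d := by positivity
  refine ⟨(pi_norm_le_iff_of_nonneg (by positivity)).2 fun i => (e2 i).trans (by linarith),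
    (pi_norm_le_iff_of_nonneg (by positivity)).2 fun i => ?_⟩
  have s1 := hX'.slip t ht i
  have s2 := hX.slip t ht i
  have e3 : |kappa sc i * ((X' t).V i - (X t).V i)| ≤ M * (M * (Cτ + L) * d) := by
    rw [abs_mul, abs_of_pos (kappa_pos sc i)]
    exact mul_le_mul (hκ i).2 (e2 i) (abs_nonneg _) hM
  have e4 := e1 i
  have e5 : (F.eval p' (X' t) - F.eval p (X t)) i
      = -(kappa sc i * ((X' t).V i - (X t).V i))
        - (tauEll sc 1 (X' t) i - tauEll sc 1 (X t) i) := by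
    rw [Pi.sub_apply]; linarith
  rw [Real.norm_eq_abs, e5]
  rw [abs_le] at *
  constructor <;> nlinarith [e3.1, e3.2, e4.1, e4.2]

/-- Forward solutions depend Lipschitz continuously on the parameter and the initial state, in the
sense of a bound at one fixed base solution. The fencing theorem for derivatives provides both the
Grönwall estimate and the fact that the perturbed solution stays in the tube where the laws are
controlled. -/
theorem exists_stability_bound (hT : 0 < T) {P : Fin m → Set ℝ} (hP : ∀ i, IsOpen (P i))
    (hmono : ∀ i Ψ, ∀ a ∈ P i, Monotone fun V => F i V Ψ a) (hp : ∀ i, p i ∈ P i)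
    (hF : F.IsC1Along p X (Icc 0 T)) (hG : G.IsC1Along p X (Icc 0 T))
    (hX : IsForward sc T F G u0 v0 p Ψ0 X) :
    ∃ C ≥ 1, ∃ r₀ > 0, ∀ r, 0 < r → r ≤ r₀ → ∀ p' Ψ0' : Fin m → ℝ, ∀ X' : ℝ → State sc,
      IsForward sc T F G u0 v0 p' Ψ0' X' → ‖p' - p‖ ≤ r → ‖Ψ0' - Ψ0‖ ≤ r →
      ∀ t ∈ Icc 0 T, ‖(X' t).vec - (X t).vec‖ ≤ C * r ∧ ‖(X' t).Ψ - (X t).Ψ‖ ≤ C * r ∧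
        ‖(X' t).V - (X t).V‖ ≤ C * r := by
  have hS : IsCompact (Icc 0 T) := isCompact_Icc
  have hV := continuousOn_slip (fun i Ψ => hmono i Ψ (p i) (hp i)) hF hX.flux hX.continuousOn_vec
    hX.continuousOn_Ψ
  obtain ⟨C₁, hC₁, δF, hδF, hslip⟩ := exists_slip_bound hS hF hX.flux hV hX.continuousOn_Ψ
  obtain ⟨L, hL, δG, hδG, hLip⟩ := hG.exists_lipschitz_bound hS hV hX.continuousOn_Ψ
  obtain ⟨CR, hCR, hrate⟩ := exists_norm_map_le (forwardRateLin sc)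
  obtain ⟨ρ, hρ, hball⟩ : ∃ ρ > 0, ∀ p' : Fin m → ℝ, ‖p' - p‖ < ρ → ∀ i, p' i ∈ P i := by
    have h : ∀ᶠ p' in 𝓝 p, ∀ i, p' i ∈ P i := eventually_all.2 fun i =>
      (continuous_apply i).continuousAt.eventually ((hP i).mem_nhds (hp i))
    obtain ⟨ρ, hρ, h⟩ := Metric.eventually_nhds_iff.1 h
    exact ⟨ρ, hρ, fun p' hp' => h (by rwa [dist_eq_norm])⟩
  -- The summand `1` makes the fence `r * exp (K t)` grow strictly faster than the difference of the
  -- two solutions can when it touches the fence.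
  set K : ℝ := CR * C₁ + L * C₁ + 1
  have hC₁0 : 0 ≤ C₁ := zero_le_one.trans hC₁
  have hK : 0 ≤ K := by positivity
  set E : ℝ := Real.exp (K * T)
  have hE : 1 ≤ E := Real.one_le_exp (by positivity)
  have hE0 : 0 < E := zero_lt_one.trans_le hE
  refine ⟨C₁ * E, one_le_mul_of_one_le_of_one_le hC₁ hE,
    min (ρ / 2) (min (δF / E) (δG / (C₁ * E))), by positivity,
    fun r hr hrr p' Ψ0' X' hX' hpr hΨr => ?_⟩
  have r1 : r < ρ := by linarith [hrr.trans (min_le_left _ _)]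
  have r2 : r * E ≤ δF :=
    (le_div_iff₀ hE0).1 (hrr.trans ((min_le_right _ _).trans (min_le_left _ _)))
  have r3 : r * (C₁ * E) ≤ δG :=
    (le_div_iff₀ (by positivity)).1 (hrr.trans ((min_le_right _ _).trans (min_le_right _ _)))
  have hP' := hball p' (hpr.trans_lt r1)
  have slipAt := fun d h0 h1 hd => hslip d h0 h1 p' X' hX'.flux
    (fun i Ψ => hmono i Ψ _ (hP' i)) hd
  have fence : ∀ t ∈ Icc 0 T,
      ‖((X' t).vec - (X t).vec, (X' t).Ψ - (X t).Ψ)‖ ≤ r * Real.exp (K * t) := by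
    intro t ht
    have hder : ∀ t ∈ Icc 0 T, HasDerivWithinAt
        (fun t => ((X' t).vec - (X t).vec, (X' t).Ψ - (X t).Ψ))
        (forwardRate sc (X' t) (F.eval p' (X' t)) - forwardRate sc (X t) (F.eval p (X t)),
          G.eval p' (X' t) - G.eval p (X t)) (Icc 0 T) t := fun t ht =>
      ((hX'.hasDerivWithinAt_vec ht).fun_sub (hX.hasDerivWithinAt_vec ht)).prodMk
        ((hX'.state t ht).fun_sub (hX.state t ht))
    refine image_norm_le_of_norm_deriv_right_lt_deriv_boundary
      (B' := fun t => r * (Real.exp (K * t) * (K * 1)))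
      (fun t ht => (hder t ht).continuousWithinAt)
      (fun t ht => (hder t (Ico_subset_Icc_self ht)).mono_of_mem_nhdsWithin
        (Icc_mem_nhdsGE_of_mem ht)) ?_
      (fun t => (((hasDerivAt_id t).const_mul K).exp).const_mul r) ?_ ht
    · rw [hX'.vec_zero, hX.vec_zero, hX'.init_Ψ, hX.init_Ψ, sub_self]
      simpa [Prod.norm_def] using hΨr
    · intro t ht hB
      have ht' := Ico_subset_Icc_self ht
      set d := r * Real.exp (K * t) with hd
      have hexp : 1 ≤ Real.exp (K * t) := Real.one_le_exp (mul_nonneg hK ht.1)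
      have hexpE : Real.exp (K * t) ≤ E :=
        Real.exp_le_exp.2 (mul_le_mul_of_nonneg_left ht.2.le hK)
      have hd0 : 0 < d := by positivity
      have hrd : r ≤ d := le_mul_of_one_le_right hr.le hexp
      have hdE : d ≤ r * E := mul_le_mul_of_nonneg_left hexpE hr.le
      have hn := hB.le
      rw [Prod.norm_def, sup_le_iff] at hn
      obtain ⟨b1, b2⟩ := slipAt d hd0.le (hdE.trans r2) (hpr.trans hrd) t ht' hn.1 hn.2
      have hdC : d ≤ C₁ * d := le_mul_of_one_le_left hd0.le hC₁
      have g1 : ‖forwardRate sc (X' t) (F.eval p' (X' t))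
          - forwardRate sc (X t) (F.eval p (X t))‖ ≤ CR * (C₁ * d) := by
        rw [forwardRate_eq, forwardRate_eq, ← map_sub]
        refine (hrate _).trans (mul_le_mul_of_nonneg_left ?_ hCR)
        rw [Prod.norm_def, sup_le_iff]
        exact ⟨hn.1.trans hdC, b2⟩
      have g2 : ‖G.eval p' (X' t) - G.eval p (X t)‖ ≤ L * (C₁ * d) := by
        refine (pi_norm_le_iff_of_nonneg (by positivity)).2 fun i => ?_
        refine hLip (C₁ * d) ?_ t ht' i _ _ _ ((norm_le_pi_norm ((X' t).V - (X t).V) i).trans b1)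
          ((norm_le_pi_norm ((X' t).Ψ - (X t).Ψ) i).trans (hn.2.trans hdC))
          ((norm_le_pi_norm (p' - p) i).trans (hpr.trans (hrd.trans hdC)))
        calc C₁ * d ≤ C₁ * (r * E) := mul_le_mul_of_nonneg_left hdE hC₁0
          _ = r * (C₁ * E) := by ring
          _ ≤ δG := r3
      have g3 : CR * (C₁ * d) ≤ (K - 1) * d ∧ L * (C₁ * d) ≤ (K - 1) * d := by
        have q1 : 0 ≤ CR * (C₁ * d) := by positivity
        have q2 : 0 ≤ L * (C₁ * d) := by positivity
        have q3 : (K - 1) * d = CR * (C₁ * d) + L * (C₁ * d) := by simp only [K]; ring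
        constructor <;> linarith
      calc _ ≤ (K - 1) * d := by
            rw [Prod.norm_def, sup_le_iff]
            exact ⟨g1.trans g3.1, g2.trans g3.2⟩
        _ < K * d := by nlinarith
        _ = r * (Real.exp (K * t) * (K * 1)) := by rw [hd]; ring
  intro t ht
  have hE' : r * Real.exp (K * t) ≤ r * E := mul_le_mul_of_nonneg_left
    (Real.exp_le_exp.2 (mul_le_mul_of_nonneg_left ht.2 hK)) hr.le
  have hn := (fence t ht).trans hE'
  rw [Prod.norm_def, sup_le_iff] at hn
  have b := (slipAt (r * E) (by positivity) r2
    (hpr.trans (le_mul_of_one_le_right hr.le hE)) t ht hn.1 hn.2).1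
  have hle : r * E ≤ C₁ * E * r := by
    have : 0 ≤ r * E := by positivity
    nlinarith
  exact ⟨hn.1.trans hle, hn.2.trans hle, b.trans (by linarith)⟩

end Stability

/-! ### Dual consistency -/

lemma integral_eq_sub_of_hasDerivWithinAt_Icc {T : ℝ} (hT : 0 ≤ T) {f f' : ℝ → ℝ}
    (hf : ∀ t ∈ Icc 0 T, HasDerivWithinAt f (f' t) (Icc 0 T) t)
    (hf' : ContinuousOn f' (Icc 0 T)) : ∫ t in (0 : ℝ)..T, f' t = f T - f 0 :=
  intervalIntegral.integral_eq_sub_of_hasDerivAt_of_le hT (fun t ht => (hf t ht).continuousWithinAt)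
    (fun t ht => (hf t (Ioo_subset_Icc_self ht)).hasDerivAt (Icc_mem_nhds ht.1 ht.2))
    (hf'.intervalIntegrable_of_Icc hT)

lemma continuousOn_finset_sum_univ {ι : Type*} [Fintype ι] {f : ι → ℝ → ℝ} {S : Set ℝ}
    (hf : ∀ i, ContinuousOn (f i) S) : ContinuousOn (fun t => ∑ i, f i t) S :=
  continuousOn_finsetSum _ fun i _ => hf i

section Dual

variable {m : ℕ} {sc : Scheme m} {T : ℝ} {F G : FaultLaw m} {p : Fin m → ℝ} {X : ℝ → State sc}

/-- The energy balance, with the fault contribution `Φ V_z - Θ V_y` absorbed into the pairing of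
the state equations. Both integrands are continuous, so that the integrals may be split. -/
theorem dualConsistent (hT : 0 < T) (hF : F.IsC1Along p X (Icc 0 T))
    (hG : G.IsC1Along p X (Icc 0 T)) (hFV : ∀ t ∈ Icc 0 T, ∀ i, 0 < F.dV p (X t) i)
    (hV : ContinuousOn (fun t => (X t).V) (Icc 0 T))
    (hΨ : ContinuousOn (fun t => (X t).Ψ) (Icc 0 T)) : DualConsistent sc T F G p X := by
  intro y z hy hz hy0 hzT yv zv yΨ zΨ
  have hu := uniqueDiffOn_Icc hT
  have cFV := hF.continuousOn_dV hV hΨ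
  have cFΨ := hF.continuousOn_dΨ hV hΨ
  have cGV := hG.continuousOn_dV hV hΨ
  have cGΨ := hG.continuousOn_dΨ hV hΨ
  have cyvec := hy.continuousOn_vec one_ne_zero fun s => (yv s).continuousOn
  have czvec := hz.continuousOn_vec (neg_ne_zero.2 one_ne_zero) fun s => (zv s).continuousOn
  have cyV := continuousOn_slip_linear (g := fun t => F.dΨ p (X t) * (y t).Ψ) hy cFV
    (cFΨ.mul yΨ.continuousOn) hFV cyvec
  have czV := continuousOn_slip_linear (g := fun t => G.dV p (X t) * (z t).Ψ) hz cFV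
    (cGV.mul zΨ.continuousOn) hFV czvec
  have cΦ : ContinuousOn (fun t => F.lin p (X t) (y t)) (Icc 0 T) :=
    (cFV.mul cyV).add (cFΨ.mul yΨ.continuousOn)
  have cΘ : ContinuousOn (fun t => adjF F G p (X t) (z t)) (Icc 0 T) :=
    (cFV.mul czV).add (cGV.mul zΨ.continuousOn)
  have cGlin : ContinuousOn (fun t => G.lin p (X t) (y t)) (Icc 0 T) :=
    (cGV.mul cyV).add (cGΨ.mul yΨ.continuousOn)
  have cadjG : ContinuousOn (fun t => adjG F G p (X t) (z t)) (Icc 0 T) :=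
    (cGΨ.mul zΨ.continuousOn).add (cFΨ.mul czV)
  have cA : ContinuousOn (fun t => (∑ s, ip (sc.blk s).h ((z t).v s)
      ((sc.blk s).ρ * derivWithin (fun r => (y r).v s) (Icc 0 T) t
        - opL sc 1 (F.lin p (X t) (y t)) (y t) s))
      + ip sc.hΓ (z t).Ψ
        (derivWithin (fun r => (y r).Ψ) (Icc 0 T) t - G.lin p (X t) (y t))) (Icc 0 T) :=
    (continuousOn_finset_sum_univ fun s => continuousOn_ip _ (zv s).continuousOn
      ((continuousOn_const.mul ((yv s).continuousOn_derivWithin hu le_rfl)).sub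
        (continuousOn_opL cyvec cΦ s))).add
      (continuousOn_ip _ zΨ.continuousOn ((yΨ.continuousOn_derivWithin hu le_rfl).sub cGlin))
  have cB : ContinuousOn (fun t => (∑ s, ip (sc.blk s).h
      ((sc.blk s).ρ * derivWithin (fun r => (z r).v s) (Icc 0 T) t
        - opL sc (-1) (adjF F G p (X t) (z t)) (z t) s) ((y t).v s))
      + ip sc.hΓ (derivWithin (fun r => (z r).Ψ) (Icc 0 T) t + adjG F G p (X t) (z t)) (y t).Ψ)
      (Icc 0 T) :=
    (continuousOn_finset_sum_univ fun s => continuousOn_ip _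
      ((continuousOn_const.mul ((zv s).continuousOn_derivWithin hu le_rfl)).sub
        (continuousOn_opL czvec cΘ s)) (yv s).continuousOn).add
      (continuousOn_ip _ ((zΨ.continuousOn_derivWithin hu le_rfl).add cadjG) yΨ.continuousOn)
  rw [eq_neg_iff_add_eq_zero, ← intervalIntegral.integral_add
    (cA.intervalIntegrable_of_Icc hT.le) (cB.intervalIntegrable_of_Icc hT.le)]
  have key := integral_eq_sub_of_hasDerivWithinAt_Icc hT.le
    (f := fun t => energyPairing sc (y t) (z t) + ip sc.hΓ (z t).Ψ (y t).Ψ)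
    (fun t ht => ?_) (cA.fun_add cB)
  · rw [key, energyPairing_of_isZero_right hzT, energyPairing_of_isZero_left hy0, hzT.Ψ, hy0.Ψ]
    simp
  · have hd : ∀ {k : ℕ} {f : ℝ → Fin k → ℝ}, ContDiffOn ℝ 1 f (Icc 0 T) →
        HasDerivWithinAt f (derivWithin f (Icc 0 T) t) (Icc 0 T) t := fun hf =>
      (hf.differentiableOn one_ne_zero t ht).hasDerivWithinAt
    refine ((hasDerivWithinAt_energyPairing hy hz ht (fun s => hd (yv s))
      (fun s => hd (zv s))).add (hasDerivWithinAt_ip sc.hΓ (hd zΨ) (hd yΨ))).congr_deriv ?_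
    have fault : ip sc.hΓ (F.lin p (X t) (y t)) (z t).V
        - ip sc.hΓ (adjF F G p (X t) (z t)) (y t).V
        = ip sc.hΓ (adjG F G p (X t) (z t)) (y t).Ψ - ip sc.hΓ (z t).Ψ (G.lin p (X t) (y t)) := by
      simp only [ip, ← Finset.sum_sub_distrib]
      refine Finset.sum_congr rfl fun i _ => ?_
      simp only [FaultLaw.lin, adjF, adjG, Pi.add_apply, Pi.mul_apply]
      ring
    have e : ip sc.hΓ (derivWithin (fun r => (z r).Ψ) (Icc 0 T) t + adjG F G p (X t) (z t)) (y t).Ψ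
        = ip sc.hΓ (derivWithin (fun r => (z r).Ψ) (Icc 0 T) t) (y t).Ψ
          + ip sc.hΓ (adjG F G p (X t) (z t)) (y t).Ψ := by
      rw [ip_comm, ip_add_right, ip_comm, ip_comm _ (y t).Ψ]
    rw [fault, ip_sub_right sc.hΓ, e]
    ring

end Dual

/-! ### First-order expansion of the misfit -/

section Misfit

variable {m : ℕ} {sc : Scheme m} {T : ℝ}

/-- The receiver signals without data, as a linear function of the linear unknowns. -/
def measureLin (rec : Receivers sc) (q : Quantity) : Vec sc →ₗ[ℝ] (Fin rec.N → ℝ) :=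
  linearMapOfSMulAdd (fun w k => ∑ s, ip (sc.blk s).h (rec.δ k s) (q.field (ofVec w) s)) <| by
    intro c w w'
    funext k
    rw [Pi.add_apply, Pi.smul_apply, smul_eq_mul, Finset.mul_sum, ← Finset.sum_add_distrib]
    refine Finset.sum_congr rfl fun s _ => ?_
    rw [ip, ip, ip, Finset.mul_sum, ← Finset.sum_add_distrib]
    refine Finset.sum_congr rfl fun i _ => ?_
    cases q <;>
    · simp only [Quantity.field, ofVec, Prod.fst_add, Prod.snd_add, Prod.smul_fst,
        Prod.smul_snd, Pi.add_apply, Pi.smul_apply, smul_eq_mul]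
      ring

variable {rec : Receivers sc} {q : Quantity}

lemma residual_eq (X : ℝ → State sc) (k : Fin rec.N) (t : ℝ) :
    residual rec q X k t = measureLin rec q (X t).vec k - rec.data k t := by
  cases q <;> rfl

lemma continuousOn_measureLin {X : ℝ → State sc} {S : Set ℝ}
    (hX : ContinuousOn (fun t => (X t).vec) S) (k : Fin rec.N) :
    ContinuousOn (fun t => measureLin rec q (X t).vec k) S :=
  continuousOn_pi.1
    ((measureLin rec q).continuous_of_finiteDimensional.comp_continuousOn hX) k

lemma continuousOn_residual {X : ℝ → State sc} (hdata : ∀ k, ContinuousOn (rec.data k) (Icc 0 T))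
    (hX : ContinuousOn (fun t => (X t).vec) (Icc 0 T)) (k : Fin rec.N) :
    ContinuousOn (residual rec q X k) (Icc 0 T) :=
  ((continuousOn_measureLin hX k).sub (hdata k)).congr fun t _ => residual_eq X k t

/-- The misfit is quadratic in the measured signal. -/
lemma exists_misfit_bound (hT : 0 ≤ T) (rec : Receivers sc) (q : Quantity)
    (hdata : ∀ k, ContinuousOn (rec.data k) (Icc 0 T)) :
    ∃ C ≥ 0, ∀ X X' : ℝ → State sc, ContinuousOn (fun t => (X t).vec) (Icc 0 T) →
      ContinuousOn (fun t => (X' t).vec) (Icc 0 T) → ∀ R,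
      (∀ t ∈ Icc 0 T, ‖(X' t).vec - (X t).vec‖ ≤ R) →
      |misfit T rec q X' - misfit T rec q X - ∑ k, ∫ t in (0 : ℝ)..T,
        residual rec q X k t * measureLin rec q ((X' t).vec - (X t).vec) k| ≤ C * R ^ 2 := by
  obtain ⟨A, hA, hm⟩ := exists_norm_map_le (measureLin rec q)
  refine ⟨1 / 2 * (rec.N * (A ^ 2 * T)), by positivity, fun X X' hX hX' R hR => ?_⟩
  have cd : ∀ k, ContinuousOn (fun t => measureLin rec q ((X' t).vec - (X t).vec) k)
      (Icc 0 T) := fun k =>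
    continuousOn_pi.1
      ((measureLin rec q).continuous_of_finiteDimensional.comp_continuousOn (hX'.sub hX)) k
  have cr := fun k => continuousOn_residual (q := q) hdata hX k
  have hsplit : ∀ k, (∫ t in (0 : ℝ)..T, |residual rec q X' k t| ^ 2)
      = (∫ t in (0 : ℝ)..T, |residual rec q X k t| ^ 2)
        + 2 * (∫ t in (0 : ℝ)..T,
          residual rec q X k t * measureLin rec q ((X' t).vec - (X t).vec) k)
        + ∫ t in (0 : ℝ)..T, measureLin rec q ((X' t).vec - (X t).vec) k ^ 2 := by
    intro k
    rw [← intervalIntegral.integral_const_mul, ← intervalIntegral.integral_add,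
      ← intervalIntegral.integral_add]
    · refine intervalIntegral.integral_congr fun t _ => ?_
      simp only [residual_eq, map_sub, Pi.sub_apply, sq_abs]
      ring
    · exact ((((cr k).abs).pow 2).add
        (continuousOn_const.mul ((cr k).mul (cd k)))).intervalIntegrable_of_Icc hT
    · exact ((cd k).pow 2).intervalIntegrable_of_Icc hT
    · exact (((cr k).abs).pow 2).intervalIntegrable_of_Icc hT
    · exact (continuousOn_const.mul ((cr k).mul (cd k))).intervalIntegrable_of_Icc hT
  have hquad : ∀ k, |∫ t in (0 : ℝ)..T, measureLin rec q ((X' t).vec - (X t).vec) k ^ 2|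
      ≤ (A * R) ^ 2 * T := by
    intro k
    have := intervalIntegral.norm_integral_le_of_norm_le_const (a := (0 : ℝ)) (b := T)
      (f := fun t => measureLin rec q ((X' t).vec - (X t).vec) k ^ 2) (C := (A * R) ^ 2) ?_
    · simpa [abs_of_nonneg hT] using this
    · intro t ht
      rw [uIoc_of_le hT] at ht
      rw [norm_pow]
      refine pow_le_pow_left₀ (norm_nonneg _) ?_ 2
      exact (norm_le_pi_norm _ k).trans ((hm _).trans
        (mul_le_mul_of_nonneg_left (hR t (Ioc_subset_Icc_self ht)) hA))
  have e : misfit T rec q X' - misfit T rec q X - ∑ k, ∫ t in (0 : ℝ)..T,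
      residual rec q X k t * measureLin rec q ((X' t).vec - (X t).vec) k
      = 1 / 2 * ∑ k, ∫ t in (0 : ℝ)..T, measureLin rec q ((X' t).vec - (X t).vec) k ^ 2 := by
    simp only [misfit, hsplit, Finset.sum_add_distrib, ← Finset.mul_sum]
    ring
  rw [e, abs_mul, abs_of_pos (by norm_num : (0 : ℝ) < 1 / 2), mul_assoc]
  refine mul_le_mul_of_nonneg_left ?_ (by norm_num)
  calc _ ≤ ∑ k : Fin rec.N, (A * R) ^ 2 * T :=
        (Finset.abs_sum_le_sum_abs _ _).trans (Finset.sum_le_sum fun k _ => hquad k)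
    _ = _ := by simp; ring

lemma hasDerivWithinAt_primitive {f : ℝ → ℝ} (hf : ContinuousOn f (Icc 0 T)) {t : ℝ}
    (ht : t ∈ Icc 0 T) :
    HasDerivWithinAt (fun r => ∫ x in (0 : ℝ)..r, f x) (f t) (Icc 0 T) t := by
  have : Fact (t ∈ Icc 0 T) := ⟨ht⟩
  exact intervalIntegral.integral_hasDerivWithinAt_right
    ((hf.mono (Icc_subset_Icc_right ht.2)).intervalIntegrable_of_Icc ht.1)
    (hf.stronglyMeasurableAtFilter_nhdsWithin measurableSet_Icc t) (hf t ht)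

lemma continuousOn_signal {X : ℝ → State sc} (hdata : ∀ k, ContinuousOn (rec.data k) (Icc 0 T))
    (hX : ContinuousOn (fun t => (X t).vec) (Icc 0 T)) (k : Fin rec.N) :
    ContinuousOn (signal T rec q X k) (Icc 0 T) := by
  have hr := continuousOn_residual (q := q) hdata hX k
  cases q with
  | velocity => exact hr
  | displacement =>
    exact (ContinuousOn.sub (fun t ht => (hasDerivWithinAt_primitive hr ht).continuousWithinAt)
      continuousOn_const).neg

/-- Testing the residual with the measured field of a perturbation equals testing the adjoint
source with its velocity. For displacement measurements this is an integration by parts in time,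
whose boundary terms vanish since the perturbation starts from rest and the signal ends at zero. -/
lemma sum_integral_residual_mul (hT : 0 ≤ T) {X : ℝ → State sc}
    (hdata : ∀ k, ContinuousOn (rec.data k) (Icc 0 T))
    (hX : ContinuousOn (fun t => (X t).vec) (Icc 0 T)) {y : ℝ → State sc}
    (hy : ContinuousOn (fun t => (y t).vec) (Icc 0 T))
    (hvel : ∀ t ∈ Icc 0 T, ∀ s,
      HasDerivWithinAt (fun r => (y r).u s) ((y t).v s) (Icc 0 T) t)
    (h0 : ∀ s, (y 0).u s = 0) :
    ∑ k, ∫ t in (0 : ℝ)..T, residual rec q X k t * measureLin rec q (y t).vec k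
      = ∫ t in (0 : ℝ)..T, ∑ s, ip (sc.blk s).h (adjSource T rec q X t s) ((y t).v s) := by
  have cS := fun k => continuousOn_signal (q := q) hdata hX k
  have cv : ∀ k, ContinuousOn (fun t => measureLin rec .velocity (y t).vec k) (Icc 0 T) :=
    fun k => continuousOn_measureLin hy k
  have hsrc : ∀ t, ∑ s, ip (sc.blk s).h (adjSource T rec q X t s) ((y t).v s)
      = ∑ k, signal T rec q X k t * measureLin rec .velocity (y t).vec k := by
    intro t
    have : ∀ k, measureLin rec .velocity (y t).vec k
      = ∑ s, ip (sc.blk s).h (rec.δ k s) ((y t).v s) := fun k => rfl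
    simp only [this, Finset.mul_sum]
    rw [Finset.sum_comm]
    refine Finset.sum_congr rfl fun s _ => ?_
    simp only [ip, adjSource, Finset.mul_sum, Finset.sum_mul]
    rw [Finset.sum_comm]
    refine Finset.sum_congr rfl fun k _ => Finset.sum_congr rfl fun i _ => ?_
    ring
  simp only [hsrc]
  rw [intervalIntegral.integral_finsetSum fun k _ =>
    ((cS k).fun_mul (cv k)).intervalIntegrable_of_Icc hT]
  refine Finset.sum_congr rfl fun k _ => ?_
  have cr := continuousOn_residual (q := q) hdata hX k
  cases q with
  | velocity => rfl
  | displacement =>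
    have hS : ∀ t ∈ Icc 0 T, HasDerivWithinAt (signal T rec .displacement X k)
        (-residual rec .displacement X k t) (Icc 0 T) t := fun t ht =>
      ((hasDerivWithinAt_primitive cr ht).sub_const _).fun_neg
    have hu : ∀ t ∈ Icc 0 T, HasDerivWithinAt
        (fun r => measureLin rec .displacement (y r).vec k)
        (measureLin rec .velocity (y t).vec k) (Icc 0 T) t := by
      intro t ht
      change HasDerivWithinAt (fun r => ∑ s, ip (sc.blk s).h (rec.δ k s) ((y r).u s))
        (∑ s, ip (sc.blk s).h (rec.δ k s) ((y t).v s)) (Icc 0 T) t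
      refine HasDerivWithinAt.fun_sum fun s _ => ?_
      simpa using hasDerivWithinAt_ip (sc.blk s).h
        (hasDerivWithinAt_const t (Icc 0 T) (rec.δ k s)) (hvel t ht s)
    rw [← uIcc_of_le hT] at hS hu
    have := intervalIntegral.integral_mul_deriv_eq_deriv_mul_of_hasDerivWithinAt hS hu
      (cr.neg.intervalIntegrable_of_Icc hT) ((cv k).intervalIntegrable_of_Icc hT)
    have e0 : measureLin rec .displacement (y 0).vec k = 0 := by
      change ∑ s, ip (sc.blk s).h (rec.δ k s) ((y 0).u s) = 0
      simp [h0]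
    have eT : signal T rec .displacement X k T = 0 := by simp [signal]
    rw [this, e0, eT]
    simp

end Misfit

/-! ### The gradient of the misfit -/

section Gradient

variable {m : ℕ} {sc : Scheme m} {T : ℝ} {F G : FaultLaw m} {rec : Receivers sc} {q : Quantity}
  {u0 v0 : ∀ s, Fin (sc.blk s).n → ℝ} {p Ψ0 p' Ψ0' : Fin m → ℝ} {X X' Y : ℝ → State sc}

lemma energyPairing_of_vec_eq_zero {y z : State sc} (hy : y.vec = 0) :
    energyPairing sc y z = 0 := by
  have h : energyPairing sc y z = energyPairing sc (ofVec y.vec) z := rfl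
  rw [h, hy]
  exact energyPairing_of_isZero_left
    ⟨fun _ => rfl, fun _ => rfl, fun _ _ => rfl, fun _ => rfl, rfl⟩

/-- The integrand of the gradient with respect to the parameter, before weighting with the fault
quadrature: `F_p V† + G_p Ψ†`. -/
def gradDensity (F G : FaultLaw m) (p : Fin m → ℝ) (x y : State sc) (i : Fin m) : ℝ :=
  F.dp p x i * y.V i + G.dp p x i * y.Ψ i

/-- The Taylor remainders of the laws between the base and the perturbed solution, tested with the
adjoint slip velocity and the adjoint state. -/
def adjRemainder (F G : FaultLaw m) (p p' : Fin m → ℝ) (x x' y : State sc) (i : Fin m) : ℝ :=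
  y.V i * (F.eval p' x' i - F.eval p x i
      - F.taylor p x i (x'.V i - x.V i) (x'.Ψ i - x.Ψ i) (p' i - p i))
    + y.Ψ i * (G.eval p' x' i - G.eval p x i
      - G.taylor p x i (x'.V i - x.V i) (x'.Ψ i - x.Ψ i) (p' i - p i))

/-- The energy balance of the exact difference of two forward solutions with the adjoint solution.
The adjoint laws cancel all terms that are linear in the differences of `V` and `Ψ`, so that no
linearized forward solution is needed. -/
lemma hasDerivWithinAt_adjoint_pairing (hX : IsForward sc T F G u0 v0 p Ψ0 X)
    (hX' : IsForward sc T F G u0 v0 p' Ψ0' X') (hY : IsAdjoint sc T F G rec q p X Y) {t : ℝ}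
    (ht : t ∈ Icc 0 T) :
    HasDerivWithinAt
      (fun r => energyPairing sc ((X' r).diff (X r)) (Y r)
        + ip sc.hΓ (Y r).Ψ ((X' r).Ψ - (X r).Ψ))
      ((∑ s, ip (sc.blk s).h (adjSource T rec q X t s) (((X' t).diff (X t)).v s))
        + (∑ i, sc.hΓ i * gradDensity F G p (X t) (Y t) i * (p' i - p i))
        + ∑ i, sc.hΓ i * adjRemainder F G p p' (X t) (X' t) (Y t) i) (Icc 0 T) t := by
  have hYΨ : HasDerivWithinAt (fun r => (Y r).Ψ) (-adjG F G p (X t) (Y t)) (Icc 0 T) t := by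
    simpa using (hY.state t ht).fun_neg
  have hE := hasDerivWithinAt_energyPairing (hX'.flux.diff hX.flux) hY.flux ht
    (fun s => (hX'.momentum t ht s).fun_sub (hX.momentum t ht s)) (hY.momentum t ht)
  refine (hE.add (hasDerivWithinAt_ip sc.hΓ hYΨ
    ((hX'.state t ht).fun_sub (hX.state t ht)))).congr_deriv ?_
  have hL : opL sc 1 (F.eval p' (X' t) - F.eval p (X t)) ((X' t).diff (X t))
      = opL sc 1 (F.eval p' (X' t)) (X' t) - opL sc 1 (F.eval p (X t)) (X t) := by
    rw [opL_eq, opL_eq, opL_eq, ← map_sub]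
    rfl
  have r1 : ∀ s, (sc.blk s).ρ * ((fun i => ((sc.blk s).ρ i)⁻¹
        * opL sc 1 (F.eval p' (X' t)) (X' t) s i)
        - fun i => ((sc.blk s).ρ i)⁻¹ * opL sc 1 (F.eval p (X t)) (X t) s i)
      - opL sc 1 (F.eval p' (X' t) - F.eval p (X t)) ((X' t).diff (X t)) s = 0 := by
    intro s
    ext i
    have := ((sc.blk s).ρ_pos i).ne'
    rw [hL]
    simp only [Pi.sub_apply, Pi.mul_apply, Pi.zero_apply]
    field_simp
    ring
  have r2 : ∀ s, (sc.blk s).ρ * (fun i => ((sc.blk s).ρ i)⁻¹ *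
        (opL sc (-1) (adjF F G p (X t) (Y t)) (Y t) s i + adjSource T rec q X t s i))
      - opL sc (-1) (adjF F G p (X t) (Y t)) (Y t) s = adjSource T rec q X t s := by
    intro s
    ext i
    have := ((sc.blk s).ρ_pos i).ne'
    simp only [Pi.sub_apply, Pi.mul_apply]
    field_simp
    ring
  simp only [r1, r2, ip_zero_right, Finset.sum_const_zero, zero_add]
  rw [add_assoc, add_assoc]
  congr 1
  simp only [ip, ← Finset.sum_add_distrib, ← Finset.sum_sub_distrib]
  refine Finset.sum_congr rfl fun i _ => ?_
  simp only [gradDensity, adjRemainder, FaultLaw.taylor, adjF, adjG, State.diff, Pi.sub_apply,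
    Pi.add_apply, Pi.mul_apply, Pi.neg_apply]
  ring

/-- The first-order expansion of the misfit, jointly in the parameter and the initial state, with
an error that is uniform over all forward solutions with nearby data. -/
theorem misfit_expansion (hT : 0 < T) (hdata : ∀ k, ContinuousOn (rec.data k) (Icc 0 T))
    {P : Fin m → Set ℝ} (hP : ∀ i, IsOpen (P i))
    (hmono : ∀ i Ψ, ∀ a ∈ P i, Monotone fun V => F i V Ψ a) (hp : ∀ i, p i ∈ P i)
    (hF : F.IsC1Along p X (Icc 0 T)) (hG : G.IsC1Along p X (Icc 0 T))
    (hFV : ∀ t ∈ Icc 0 T, ∀ i, 0 < F.dV p (X t) i)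
    (hX : IsForward sc T F G u0 v0 p Ψ0 X) (hY : IsAdjoint sc T F G rec q p X Y)
    {ε : ℝ} (hε : 0 < ε) :
    ∃ r₀ > 0, ∀ r, 0 < r → r ≤ r₀ → ∀ p' Ψ0' : Fin m → ℝ, ∀ X' : ℝ → State sc,
      IsForward sc T F G u0 v0 p' Ψ0' X' → ‖p' - p‖ ≤ r → ‖Ψ0' - Ψ0‖ ≤ r →
      |misfit T rec q X' - misfit T rec q X
        + (∑ i, (∫ t in (0 : ℝ)..T, sc.hΓ i * gradDensity F G p (X t) (Y t) i) * (p' i - p i))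
        + ip sc.hΓ (Y 0).Ψ (Ψ0' - Ψ0)| ≤ ε * r := by
  have hS : IsCompact (Icc 0 T) := isCompact_Icc
  have hXΨ := hX.continuousOn_Ψ
  have hV := continuousOn_slip (fun i Ψ => hmono i Ψ (p i) (hp i)) hF hX.flux hX.continuousOn_vec
    hXΨ
  have cYΨ : ContinuousOn (fun t => (Y t).Ψ) (Icc 0 T) := by
    have h : ContinuousOn (fun t => -(Y t).Ψ) (Icc 0 T) := fun t ht =>
      (hY.state t ht).continuousWithinAt
    simpa using h.fun_neg
  have cYvec := hY.flux.continuousOn_vec (neg_ne_zero.2 one_ne_zero)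
    fun s t ht => (hY.momentum t ht s).continuousWithinAt
  have cYV := continuousOn_slip_linear (g := fun t => G.dV p (X t) * (Y t).Ψ) hY.flux
    (hF.continuousOn_dV hV hXΨ) ((hG.continuousOn_dV hV hXΨ).mul cYΨ) hFV cYvec
  have cgrad : ∀ i, ContinuousOn (fun t => sc.hΓ i * gradDensity F G p (X t) (Y t) i)
      (Icc 0 T) := fun i => continuousOn_const.mul
    (((continuousOn_pi.1 (hF.continuousOn_dp hV hXΨ) i).mul (continuousOn_pi.1 cYV i)).add
      ((continuousOn_pi.1 (hG.continuousOn_dp hV hXΨ) i).mul (continuousOn_pi.1 cYΨ i)))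
  obtain ⟨A, hA⟩ := hS.exists_bound_of_continuousOn cYV
  obtain ⟨B, hB⟩ := hS.exists_bound_of_continuousOn cYΨ
  obtain ⟨C, hC, r₁, hr₁, hstab⟩ := exists_stability_bound hT hP hmono hp hF hG hX
  obtain ⟨M, hM, hmis⟩ := exists_misfit_bound hT.le rec q hdata
  have hC0 : 0 ≤ C := zero_le_one.trans hC
  have hC0' : 0 < C := zero_lt_one.trans_le hC
  have hΓ : ∀ i, 0 < sc.hΓ i := (sc.blk true).fault.h_pos
  have hH : 0 ≤ ∑ i, sc.hΓ i := Finset.sum_nonneg fun i _ => (hΓ i).le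
  -- the total weight with which the Taylor remainders of `F` and `G` enter
  set W : ℝ := (∑ i, sc.hΓ i) * (|A| + |B|) * C * T with hW
  have hW0 : 0 ≤ W := by positivity
  set η : ℝ := ε / (2 * (W + 1)) with hη
  have hη0 : 0 < η := by positivity
  obtain ⟨δF, hδF, hTF⟩ := hF.exists_taylor_bound hS hV hXΨ hη0
  obtain ⟨δG, hδG, hTG⟩ := hG.exists_taylor_bound hS hV hXΨ hη0
  refine ⟨min (min r₁ (ε / (2 * (M * C ^ 2 + 1)))) (min (δF / C) (δG / C)), by positivity,
    fun r hr hrr p' Ψ0' X' hX' hpr hΨr => ?_⟩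
  have k1 : r ≤ r₁ := hrr.trans ((min_le_left _ _).trans (min_le_left _ _))
  have k2 : r ≤ ε / (2 * (M * C ^ 2 + 1)) :=
    hrr.trans ((min_le_left _ _).trans (min_le_right _ _))
  have k3 : C * r ≤ δF := by
    rw [mul_comm]
    exact (le_div_iff₀ hC0').1 (hrr.trans ((min_le_right _ _).trans (min_le_left _ _)))
  have k4 : C * r ≤ δG := by
    rw [mul_comm]
    exact (le_div_iff₀ hC0').1 (hrr.trans ((min_le_right _ _).trans (min_le_right _ _)))
  have st := hstab r hr k1 p' Ψ0' X' hX' hpr hΨr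
  have hrC : r ≤ C * r := le_mul_of_one_le_left hr.le hC
  have cD : ContinuousOn (fun t => ((X' t).diff (X t)).vec) (Icc 0 T) :=
    hX'.continuousOn_vec.sub hX.continuousOn_vec
  have hvec0 : ((X' 0).diff (X 0)).vec = 0 := by
    rw [State.vec_diff, hX'.vec_zero, hX.vec_zero, sub_self]
  -- the expansion of the misfit in the measured signal
  have est1 := hmis X X' hX.continuousOn_vec hX'.continuousOn_vec (C * r) fun t ht => (st t ht).1
  have hsrc := sum_integral_residual_mul (q := q) (rec := rec) hT.le hdata hX.continuousOn_vec cD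
    (hX'.flux.diff hX.flux).vel fun s => congrFun (congrArg Prod.fst hvec0) s
  simp only [State.vec_diff] at hsrc
  rw [hsrc] at est1
  -- the energy balance, with the continuous part of the derivative integrated separately
  have csrc : ContinuousOn (fun t => ∑ s, ip (sc.blk s).h (adjSource T rec q X t s)
      (((X' t).diff (X t)).v s)) (Icc 0 T) := by
    refine continuousOn_finset_sum_univ fun s => continuousOn_ip _ ?_
      (continuousOn_pi.1 (continuous_snd.fst.comp_continuousOn cD) s)
    exact continuousOn_pi.2 fun i => continuousOn_finset_sum_univ fun k =>
      (continuousOn_signal hdata hX.continuousOn_vec k).mul continuousOn_const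
  have cgradsum : ContinuousOn (fun t => ∑ i, sc.hΓ i * gradDensity F G p (X t) (Y t) i
      * (p' i - p i)) (Icc 0 T) :=
    continuousOn_finset_sum_univ fun i => (cgrad i).mul continuousOn_const
  have hrem : ∀ t ∈ Icc 0 T, |∑ i, sc.hΓ i * adjRemainder F G p p' (X t) (X' t) (Y t) i|
      ≤ (∑ i, sc.hΓ i) * (|A| + |B|) * (η * (C * r)) := by
    intro t ht
    rw [mul_assoc, Finset.sum_mul]
    refine (Finset.abs_sum_le_sum_abs _ _).trans (Finset.sum_le_sum fun i _ => ?_)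
    rw [abs_mul, abs_of_pos (hΓ i)]
    refine mul_le_mul_of_nonneg_left ?_ (hΓ i).le
    obtain ⟨-, s2, s3⟩ := st t ht
    have i1 := (norm_le_pi_norm ((X' t).V - (X t).V) i).trans s3
    have i2 := (norm_le_pi_norm ((X' t).Ψ - (X t).Ψ) i).trans s2
    have i3 := (norm_le_pi_norm (p' - p) i).trans (hpr.trans hrC)
    have a1 := hTF (C * r) k3 t ht i _ _ _ i1 i2 i3
    have a2 := hTG (C * r) k4 t ht i _ _ _ i1 i2 i3
    have b1 : |(Y t).V i| ≤ |A| :=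
      ((norm_le_pi_norm (Y t).V i).trans (hA t ht)).trans (le_abs_self A)
    have b2 : |(Y t).Ψ i| ≤ |B| :=
      ((norm_le_pi_norm (Y t).Ψ i).trans (hB t ht)).trans (le_abs_self B)
    refine (abs_add_le _ _).trans ?_
    rw [abs_mul, abs_mul, add_mul]
    exact add_le_add (mul_le_mul b1 a1 (abs_nonneg _) (abs_nonneg _))
      (mul_le_mul b2 a2 (abs_nonneg _) (abs_nonneg _))
  have est2 := norm_image_sub_le_of_norm_deriv_le_segment'
    (fun t ht => ((hasDerivWithinAt_adjoint_pairing hX hX' hY ht).sub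
      ((hasDerivWithinAt_primitive csrc ht).add
        (hasDerivWithinAt_primitive cgradsum ht))).congr_deriv (add_sub_cancel_left _ _))
    (fun t ht => hrem t (Ico_subset_Icc_self ht)) T (right_mem_Icc.2 hT.le)
  have hgradsum : (∫ t in (0 : ℝ)..T, ∑ i, sc.hΓ i * gradDensity F G p (X t) (Y t) i
      * (p' i - p i))
      = ∑ i, (∫ t in (0 : ℝ)..T, sc.hΓ i * gradDensity F G p (X t) (Y t) i) * (p' i - p i) := by
    rw [intervalIntegral.integral_finsetSum fun i _ =>
      ((cgrad i).fun_mul continuousOn_const).intervalIntegrable_of_Icc hT.le]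
    exact Finset.sum_congr rfl fun i _ => intervalIntegral.integral_mul_const _ _
  simp only [Pi.sub_apply, Pi.add_apply, intervalIntegral.integral_same,
    energyPairing_of_isZero_right hY.terminal, energyPairing_of_vec_eq_zero hvec0,
    hY.terminal.Ψ, hX'.init_Ψ, hX.init_Ψ, ip_zero_left, Real.norm_eq_abs, hgradsum] at est2
  have f1 : M * (C * r) ^ 2 ≤ ε / 2 * r := by
    rw [le_div_iff₀ (by positivity)] at k2
    nlinarith
  have f2 : (∑ i, sc.hΓ i) * (|A| + |B|) * (η * (C * r)) * (T - 0) ≤ ε / 2 * r := by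
    have e1 : η * (2 * (W + 1)) = ε := div_mul_cancel₀ _ (by positivity)
    have e2 : (∑ i, sc.hΓ i) * (|A| + |B|) * (η * (C * r)) * (T - 0) = η * W * r := by
      rw [hW]; ring
    rw [e2]
    exact mul_le_mul_of_nonneg_right (by nlinarith) hr.le
  have g1 := abs_le.1 (est1.trans f1)
  have g2 := abs_le.1 (est2.trans f2)
  rw [abs_le]
  constructor <;> linarith [g1.1, g1.2, g2.1, g2.2]

/-- An error that is uniformly of first order yields a Fréchet derivative. -/
lemma hasGridGradientAt_of_expansion {f : (Fin m → ℝ) → ℝ} {g x : Fin m → ℝ}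
    (h : ∀ ε > 0, ∃ r₀ > 0, ∀ᶠ x' in 𝓝 x, ∀ r, 0 < r → r ≤ r₀ → ‖x' - x‖ ≤ r →
      |f x' - f x - ∑ i, g i * (x' i - x i)| ≤ ε * r) : HasGridGradientAt f g x := by
  refine HasFDerivAt.of_isLittleO ((Asymptotics.isLittleO_iff).2 fun ε hε => ?_)
  obtain ⟨r₀, hr₀, h⟩ := h ε hε
  filter_upwards [h, Metric.ball_mem_nhds x hr₀] with x' h1 h2
  rw [mem_ball_iff_norm] at h2
  have e : (∑ i, g i • ContinuousLinearMap.proj (R := ℝ) (φ := fun _ : Fin m => ℝ) i) (x' - x)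
      = ∑ i, g i * (x' i - x i) := by
    simp
  rw [e, Real.norm_eq_abs]
  rcases eq_or_ne x' x with rfl | hne
  · simp
  · exact h1 _ (norm_pos_iff.2 (sub_ne_zero.2 hne)) h2.le le_rfl

end Gradient

end

end AntiplaneShear

theorem lemma1 {m : ℕ} (sc : AntiplaneShear.Scheme m) (T : ℝ) (hT : 0 < T)
    (F G : AntiplaneShear.FaultLaw m)
    (rec : AntiplaneShear.Receivers sc) (q : AntiplaneShear.Quantity)
    (hdata : ∀ k, ContinuousOn (rec.data k) (Set.Icc 0 T))
    (u0 v0 : ∀ s, Fin (sc.blk s).n → ℝ)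
    -- admissible values of the parameter at each fault grid point
    (P : Fin m → Set ℝ) (hP : ∀ i, IsOpen (P i))
    (hF : ∀ i, ContDiffOn ℝ 1 (fun z : ℝ × ℝ × ℝ => F i z.1 z.2.1 z.2.2)
      (Set.univ ×ˢ Set.univ ×ˢ P i))
    (hFV : ∀ i, ∀ V Ψ, ∀ a ∈ P i, 0 < deriv (fun y => F i y Ψ a) V)
    (p Ψ0 : Fin m → ℝ) (hp : ∀ i, p i ∈ P i)
    -- the forward solutions, as functions of the parameter and of the initial state
    (X : (Fin m → ℝ) → (Fin m → ℝ) → ℝ → AntiplaneShear.State sc)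
    (hXp : ∀ᶠ p' in nhds p, AntiplaneShear.IsForward sc T F G u0 v0 p' Ψ0 (X p' Ψ0))
    (hXΨ : ∀ᶠ Ψ0' in nhds Ψ0, AntiplaneShear.IsForward sc T F G u0 v0 p Ψ0' (X p Ψ0'))
    (hG : ∀ t ∈ Set.Icc 0 T, ∀ i,
      ContDiffAt ℝ 1 (fun z : ℝ × ℝ × ℝ => G i z.1 z.2.1 z.2.2)
        ((X p Ψ0 t).V i, (X p Ψ0 t).Ψ i, p i))
    (Y : ℝ → AntiplaneShear.State sc)
    (hY : AntiplaneShear.IsAdjoint sc T F G rec q p (X p Ψ0) Y) :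
    AntiplaneShear.HasGridGradientAt
        (fun p' => AntiplaneShear.misfit T rec q (X p' Ψ0))
        (fun i => -∫ t in (0 : ℝ)..T, sc.hΓ i *
          (F.dp p (X p Ψ0 t) i * (Y t).V i + G.dp p (X p Ψ0 t) i * (Y t).Ψ i)) p ∧
      AntiplaneShear.HasGridGradientAt
        (fun Ψ0' => AntiplaneShear.misfit T rec q (X p Ψ0'))
        (fun i => -(sc.hΓ i * (Y 0).Ψ i)) Ψ0 ∧
      AntiplaneShear.DualConsistent sc T F G p (X p Ψ0) := by
  have hfwd := hXp.self_of_nhds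
  have hF1 : F.IsC1Along p (X p Ψ0) (Set.Icc 0 T) := fun t _ i =>
    (hF i).contDiffAt ((isOpen_univ.prod (isOpen_univ.prod (hP i))).mem_nhds
      ⟨trivial, trivial, hp i⟩)
  have hmono : ∀ i Ψ, ∀ a ∈ P i, Monotone fun V => F i V Ψ a := fun i Ψ a ha =>
    (strictMono_of_deriv_pos fun V => hFV i V Ψ a ha).monotone
  have hpos : ∀ t ∈ Set.Icc 0 T, ∀ i, 0 < F.dV p (X p Ψ0 t) i := fun t _ i =>
    hFV i _ _ _ (hp i)
  have hV := AntiplaneShear.continuousOn_slip (fun i Ψ => hmono i Ψ (p i) (hp i)) hF1 hfwd.flux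
    hfwd.continuousOn_vec hfwd.continuousOn_Ψ
  refine ⟨AntiplaneShear.hasGridGradientAt_of_expansion fun ε hε => ?_,
    AntiplaneShear.hasGridGradientAt_of_expansion fun ε hε => ?_,
    AntiplaneShear.dualConsistent hT hF1 hG hpos hV hfwd.continuousOn_Ψ⟩
  · obtain ⟨r₀, hr₀, h⟩ := AntiplaneShear.misfit_expansion hT hdata hP hmono hp hF1 hG hpos hfwd
      hY hε
    refine ⟨r₀, hr₀, hXp.mono fun p' hX' r hr hrr hpr => ?_⟩
    have := h r hr hrr p' Ψ0 _ hX' hpr (by simpa using hr.le)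
    simpa [AntiplaneShear.gradDensity, sub_eq_add_neg] using this
  · obtain ⟨r₀, hr₀, h⟩ := AntiplaneShear.misfit_expansion hT hdata hP hmono hp hF1 hG hpos hfwd
      hY hε
    refine ⟨r₀, hr₀, hXΨ.mono fun Ψ0' hX' r hr hrr hΨr => ?_⟩
    have := h r hr hrr p Ψ0' _ hX' (by simpa using hr.le) hΨr
    simpa [AntiplaneShear.ip, sub_eq_add_neg] using this
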